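/- Let $F$ be a nonarchimedean local field of characteristic $0$ and $(V,q)$ a nondegenerate quadratic space over $F$ of finite dimension $n$; let $k=\lfloor (n+1)/2\rfloor$, so that $n=2k$ or $n=2k-1$. Let $C(V)=C^+(V)\oplus C^-(V)$ be the Clifford algebra (with $v^2=q(v)$), $\alpha$ its automorphism that is $\pm1$ on $C^\pm(V)$, and $x\mapsto x^*$ the canonical involution, $(v_1\cdots v_\ell)^*=v_\ell\cdots v_1$. Put $$\mathrm{GPin}(V)=\{g\in C(V)^\times:\ \alpha(g)Vg^{-1}=V\},\qquad \mathrm{GSpin}(V)=\{g\in C^+(V)^\times:\ gVg^{-1}=V\},$$ let $P:\mathrm{GPin}(V)\to \mathrm{O}(V)$, $P(g)v=\alpha(g)vg^{-1}$, be the canonical projection, and let $\mathrm{sign}:\mathrm{GPin}(V)\to\{\pm1\}$ be the character with kernel $\mathrm{GSpin}(V)$. Let $\sigma_V(g)=g^*$ if $n=2k$ and $\sigma_V(g)=\mathrm{sign}(g)^{k+1}g^*$ if $n=2k-1$. Let $g\in\mathrm{GPin}(V)$ be semisimple and $h=P(g)$. Let $V_\pm=\ker(h\mp1)$, and let $V_1,\dots,V_m$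 be the distinct subspaces of the form $\ker p(h)+\ker p(h^{-1})$, where $p$ runs through the monic irreducible factors of the minimal polynomial of $h$ other than $x-1$ and $x+1$. Then $V=V_1\oplus\cdots\oplus V_m\oplus V_+\oplus V_-$ is an orthogonal direct sum, each $\dim V_i=2k_i$ is even, and there is $\eta\in\mathrm{GPin}(V)$ with $$\eta\,\sigma_V(g)\,\eta^{-1}=g.$$ If moreover $g\in\mathrm{GSpin}(V)$, then $\dim V_-=2k_-$ is even, and for every $\delta\in\{\pm1\}$ (with $\delta=1$ if $V_+=0$) the element $\eta$ can be chosen so that $P(\eta)$ preserves each of the subspaces, $$P(\eta)=(\beta_1,\dots,\beta_m,\beta_+,\beta_-)\in \mathrm{O}(V_1)\times\cdots\times \mathrm{O}(V_m)\times \mathrm{O}(V_+)\times \mathrm{O}(V_-),$$ with $\det\beta_i=(-1)^{k_i}$ for all $i$, $\det\beta_+=\delta$ and $\det\beta_-=(-1)^{k_-}$. In particular, for a suitable choice of $\delta$, such an $\eta$ also satisfies $\det P(\eta)=(-1)^k$. -/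

import Mathlib

open CliffordAlgebra Polynomial

noncomputable section

namespace GeneralPin

section

variable {F : Type*} [Field F] {V : Type*} [AddCommGroup V] [Module F V]
variable (Q : QuadraticForm F V)

/-- The general Pin group: the units `g` of the Clifford algebra `C(V)` with
`α(g) V g⁻¹ = V`, where `α` is the grading automorphism (`involute`). -/
def GPin : Subgroup (CliffordAlgebra Q)ˣ where
  carrier := {g | (fun x : CliffordAlgebra Q =>
    involute (g : CliffordAlgebra Q) * x * (↑g⁻¹ : CliffordAlgebra Q)) ''
      Set.range (ι Q) = Set.range (ι Q)}
  one_mem' := by simp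
  mul_mem' := by
    intro a b ha hb
    simp only [Set.mem_ofPred_eq] at ha hb ⊢
    nth_rewrite 2 [← ha]
    nth_rewrite 2 [← hb]
    rw [Set.image_image]
    refine Set.image_congr fun x _ => ?_
    simp [mul_assoc]
  inv_mem' := by
    intro a ha
    simp only [Set.mem_ofPred_eq] at ha ⊢
    nth_rewrite 1 [← ha]
    rw [Set.image_image]
    have h1 : involute (↑a⁻¹ : CliffordAlgebra Q) * involute (a : CliffordAlgebra Q) = 1 := by
      rw [← map_mul, Units.inv_mul, map_one]
    have h2 : ∀ x : CliffordAlgebra Q, involute (↑a⁻¹ : CliffordAlgebra Q) *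
        (involute (a : CliffordAlgebra Q) * x * (↑a⁻¹ : CliffordAlgebra Q)) *
          (↑(a⁻¹)⁻¹ : CliffordAlgebra Q) = x := by
      intro x
      rw [← mul_assoc, ← mul_assoc, h1, one_mul, inv_inv, Units.inv_mul_cancel_right]
    simp only [h2, Set.image_id']

/-- The general Spin group: the units `g` of the even Clifford algebra `C⁺(V)` with
`g V g⁻¹ = V`. -/
def GSpin : Subgroup (CliffordAlgebra Q)ˣ where
  carrier := {g | (g : CliffordAlgebra Q) ∈ even Q ∧ (↑g⁻¹ : CliffordAlgebra Q) ∈ even Q ∧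
    (fun x : CliffordAlgebra Q =>
      (g : CliffordAlgebra Q) * x * (↑g⁻¹ : CliffordAlgebra Q)) ''
        Set.range (ι Q) = Set.range (ι Q)}
  one_mem' := by simp [one_mem]
  mul_mem' := by
    rintro a b ⟨ha, ha', hA⟩ ⟨hb, hb', hB⟩
    refine ⟨by simpa using mul_mem ha hb, by simpa using mul_mem hb' ha', ?_⟩
    nth_rewrite 2 [← hA]
    nth_rewrite 2 [← hB]
    rw [Set.image_image]
    refine Set.image_congr fun x _ => ?_
    simp [mul_assoc]
  inv_mem' := by
    rintro a ⟨ha, ha', hA⟩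
    refine ⟨ha', by simpa using ha, ?_⟩
    nth_rewrite 1 [← hA]
    rw [Set.image_image]
    have h2 : ∀ x : CliffordAlgebra Q, (↑a⁻¹ : CliffordAlgebra Q) *
        ((a : CliffordAlgebra Q) * x * (↑a⁻¹ : CliffordAlgebra Q)) *
          (↑(a⁻¹)⁻¹ : CliffordAlgebra Q) = x := by
      intro x
      rw [← mul_assoc, ← mul_assoc, Units.inv_mul, one_mul, inv_inv,
        Units.inv_mul_cancel_right]
    simp only [h2, Set.image_id']

variable {Q}

/-- `g` is semisimple, as an element of the linear algebraic group `GPin(V)`. Over a field of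
characteristic zero this means that `g` acts semisimply in the faithful representation of
`GPin(V)` on `C(V)` by left multiplication. -/
def IsSemisimpleElt (g : GPin Q) : Prop :=
  Module.End.IsSemisimple
    (LinearMap.mulLeft F ((g : (CliffordAlgebra Q)ˣ) : CliffordAlgebra Q))

/-! ### The canonical projection `P : GPin(V) → O(V)` -/

theorem iota_injective [NeZero (2 : F)] : Function.Injective (ι Q) := by
  have : Invertible (2 : F) := invertibleOfNonzero (NeZero.ne 2)
  intro x y hxy
  have h := congrArg (equivExterior Q) hxy
  simp only [equivExterior, changeFormEquiv_apply, changeForm_ι] at h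
  exact (ExteriorAlgebra.ι_inj (R := F) x y).1 h

theorem exists_iota (g : GPin Q) (v : V) : ∃ w : V, ι Q w =
    involute ((g : (CliffordAlgebra Q)ˣ) : CliffordAlgebra Q) * ι Q v *
      ((g⁻¹ : GPin Q) : (CliffordAlgebra Q)ˣ) := by
  have h : _ ∈ Set.range (ι Q) := g.2 ▸ Set.mem_image_of_mem _ (Set.mem_range_self v)
  exact h

/-- The map underlying the canonical projection: `P(g) v = α(g) v g⁻¹`, the product being
formed in `C(V) ⊇ V`. -/
def projFun (g : GPin Q) (v : V) : V := (exists_iota g v).choose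

theorem iota_projFun (g : GPin Q) (v : V) : ι Q (projFun g v) =
    involute ((g : (CliffordAlgebra Q)ˣ) : CliffordAlgebra Q) * ι Q v *
      ((g⁻¹ : GPin Q) : (CliffordAlgebra Q)ˣ) :=
  (exists_iota g v).choose_spec

theorem projFun_projFun [NeZero (2 : F)] (g h : GPin Q) (v : V) :
    projFun g (projFun h v) = projFun (g * h) v := by
  apply iota_injective (Q := Q)
  simp only [iota_projFun, Subgroup.coe_mul, Units.val_mul, map_mul, mul_inv_rev, mul_assoc]

theorem projFun_one [NeZero (2 : F)] (v : V) : projFun (1 : GPin Q) v = v := by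
  apply iota_injective (Q := Q)
  simp [iota_projFun]

theorem map_projFun [NeZero (2 : F)] (g : GPin Q) (v : V) : Q (projFun g v) = Q v := by
  have : Invertible (2 : F) := invertibleOfNonzero (NeZero.ne 2)
  apply FaithfulSMul.algebraMap_injective F (CliffordAlgebra Q)
  have h1 := iota_projFun g v
  have h2 := congrArg involute h1
  simp only [map_mul, involute_ι, involute_involute, mul_neg, neg_mul, neg_inj] at h2
  have h3 : involute (((g⁻¹ : GPin Q) : (CliffordAlgebra Q)ˣ) : CliffordAlgebra Q) *
      involute ((g : (CliffordAlgebra Q)ˣ) : CliffordAlgebra Q) = 1 := by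
    rw [← map_mul]; simp
  have h4 : involute ((g : (CliffordAlgebra Q)ˣ) : CliffordAlgebra Q) *
      involute (((g⁻¹ : GPin Q) : (CliffordAlgebra Q)ˣ) : CliffordAlgebra Q) = 1 := by
    rw [← map_mul]; simp
  have h5 : (((g⁻¹ : GPin Q) : (CliffordAlgebra Q)ˣ) : CliffordAlgebra Q) *
      ((g : (CliffordAlgebra Q)ˣ) : CliffordAlgebra Q) = 1 := by simp
  rw [← ι_sq_scalar, ← ι_sq_scalar]
  nth_rewrite 1 [h1]
  rw [h2]
  calc _ = involute ((g : (CliffordAlgebra Q)ˣ) : CliffordAlgebra Q) * (ι Q v *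
        ((((g⁻¹ : GPin Q) : (CliffordAlgebra Q)ˣ) : CliffordAlgebra Q) *
        ((g : (CliffordAlgebra Q)ˣ) : CliffordAlgebra Q)) * ι Q v) *
        involute (((g⁻¹ : GPin Q) : (CliffordAlgebra Q)ˣ) : CliffordAlgebra Q) := by
          simp only [mul_assoc]
    _ = _ := by
          rw [h5, mul_one, ι_sq_scalar, ← Algebra.commutes, mul_assoc, h4, mul_one]

/-- The canonical projection `P : GPin(V) → O(V)`, `P(g) v = α(g) v g⁻¹`. -/
def proj [NeZero (2 : F)] (g : GPin Q) : Q.IsometryEquiv Q where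
  toFun := projFun g
  map_add' x y := by
    apply iota_injective (Q := Q)
    simp only [iota_projFun, map_add, mul_add, add_mul]
  map_smul' c x := by
    apply iota_injective (Q := Q)
    simp only [iota_projFun, map_smul, RingHom.id_apply, mul_smul_comm, smul_mul_assoc]
  invFun := projFun g⁻¹
  left_inv v := by rw [projFun_projFun, inv_mul_cancel, projFun_one]
  right_inv v := by rw [projFun_projFun, mul_inv_cancel, projFun_one]
  map_app' v := map_projFun g v

/-- The `F`-linear endomorphism of `V` underlying an element of `O(V)`. -/
def toEnd (h : Q.IsometryEquiv Q) : Module.End F V := (h.toLinearEquiv : V →ₗ[F] V)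

/-! ### The involution `σ_V` -/

/-- The canonical involution `g ↦ g*` on the unit group of the Clifford algebra; it reverses
products of vectors. -/
def reverseUnit (g : (CliffordAlgebra Q)ˣ) : (CliffordAlgebra Q)ˣ where
  val := reverse (g : CliffordAlgebra Q)
  inv := reverse (↑g⁻¹ : CliffordAlgebra Q)
  val_inv := by rw [← reverse.map_mul, Units.inv_mul, reverse.map_one]
  inv_val := by rw [← reverse.map_mul, Units.mul_inv, reverse.map_one]

theorem reverseUnit_mem {g : (CliffordAlgebra Q)ˣ} (hg : g ∈ GPin Q) :
    reverseUnit g ∈ GPin Q := by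
  have hg' : (fun x : CliffordAlgebra Q =>
    involute (g : CliffordAlgebra Q) * x * (↑g⁻¹ : CliffordAlgebra Q)) ''
      Set.range (ι Q) = Set.range (ι Q) := hg
  have hinv : ∀ x ∈ Set.range (ι Q), involute x = -x ∧ reverse x = x := by
    rintro _ ⟨v, rfl⟩
    exact ⟨involute_ι v, reverse_ι v⟩
  change (fun x : CliffordAlgebra Q => involute (reverse (g : CliffordAlgebra Q)) * x *
    reverse (↑g⁻¹ : CliffordAlgebra Q)) '' Set.range (ι Q) = Set.range (ι Q)
  have e1 : involute (reverse (g : CliffordAlgebra Q)) *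
      involute (reverse (↑g⁻¹ : CliffordAlgebra Q)) = 1 := by
    rw [← map_mul, ← reverse.map_mul, Units.inv_mul, reverse.map_one, map_one]
  have e2 : reverse (g : CliffordAlgebra Q) * reverse (↑g⁻¹ : CliffordAlgebra Q) = 1 := by
    rw [← reverse.map_mul, Units.inv_mul, reverse.map_one]
  -- every vector of the form `α(g) v g⁻¹` is carried back to `v`
  have key : ∀ v : V, involute (reverse (g : CliffordAlgebra Q)) *
      (involute (g : CliffordAlgebra Q) * ι Q v * (↑g⁻¹ : CliffordAlgebra Q)) *
        reverse (↑g⁻¹ : CliffordAlgebra Q) = ι Q v := by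
    intro v
    have hmem : involute (g : CliffordAlgebra Q) * ι Q v * (↑g⁻¹ : CliffordAlgebra Q) ∈
        Set.range (ι Q) := hg' ▸ Set.mem_image_of_mem _ (Set.mem_range_self v)
    obtain ⟨h1, h2⟩ := hinv _ hmem
    have h3 : involute (g : CliffordAlgebra Q) * ι Q v * (↑g⁻¹ : CliffordAlgebra Q) =
        involute (reverse (↑g⁻¹ : CliffordAlgebra Q)) * ι Q v *
          reverse (g : CliffordAlgebra Q) := by
      have h4 := h2
      rw [reverse.map_mul, reverse.map_mul, reverse_ι, reverse_involute] at h4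
      have h5 := congrArg involute h4
      rw [h1, map_mul, map_mul, involute_ι, involute_involute] at h5
      rw [← neg_inj, ← h5]
      simp [mul_assoc]
    rw [h3]
    calc _ = (involute (reverse (g : CliffordAlgebra Q)) *
          involute (reverse (↑g⁻¹ : CliffordAlgebra Q))) * ι Q v *
          (reverse (g : CliffordAlgebra Q) * reverse (↑g⁻¹ : CliffordAlgebra Q)) := by
            simp only [mul_assoc]
      _ = _ := by rw [e1, e2, one_mul, mul_one]
  nth_rewrite 1 [← hg']
  rw [Set.image_image]
  refine Set.Subset.antisymm ?_ ?_
  · rintro _ ⟨_, ⟨v, rfl⟩, rfl⟩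
    exact ⟨v, (key v).symm⟩
  · rintro _ ⟨v, rfl⟩
    exact ⟨ι Q v, Set.mem_range_self v, key v⟩

/-- The canonical involution `g ↦ g*` on `GPin(V)`. -/
def canonicalInvolution (g : GPin Q) : GPin Q :=
  ⟨reverseUnit (g : (CliffordAlgebra Q)ˣ), reverseUnit_mem g.2⟩

theorem neg_one_mem : (-1 : (CliffordAlgebra Q)ˣ) ∈ GPin Q := by
  change (fun x : CliffordAlgebra Q => involute (((-1 : (CliffordAlgebra Q)ˣ)) :
    CliffordAlgebra Q) * x * (((-1 : (CliffordAlgebra Q)ˣ)⁻¹ : (CliffordAlgebra Q)ˣ) :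
      CliffordAlgebra Q)) '' Set.range (ι Q) = Set.range (ι Q)
  simp

open Classical in
/-- The sign character of `GPin(V)`, with kernel `GSpin(V)`; its values `±1` are regarded as
elements of `F^× ⊆ GPin(V)`. -/
def sign (g : GPin Q) : GPin Q :=
  if (g : (CliffordAlgebra Q)ˣ) ∈ GSpin Q then 1 else ⟨-1, neg_one_mem⟩

/-- The number `k = [(n + 1) / 2]`, i.e. `n = 2k` or `n = 2k - 1`. -/
def halfDim (n : ℕ) : ℕ := (n + 1) / 2

/-- The involution `σ_V` of `GPin(V)`, where `n = dim V`: `σ_V(g) = g*` if `n = 2k`, and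
`σ_V(g) = sign(g)^(k+1) g*` if `n = 2k - 1`. -/
def sigmaV (g : GPin Q) : GPin Q :=
  if Even (Module.finrank F V) then canonicalInvolution g
  else sign g ^ (halfDim (Module.finrank F V) + 1) * canonicalInvolution g

/-! ### The decomposition of `V` attached to `h ∈ O(V)` -/

/-- `V₊`, on which `h` acts as `1`. -/
def plusSpace (h : Q.IsometryEquiv Q) : Submodule F V := LinearMap.ker (toEnd h - 1)

/-- `V₋`, on which `h` acts as `-1`. -/
def minusSpace (h : Q.IsometryEquiv Q) : Submodule F V := LinearMap.ker (toEnd h + 1)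

/-- The block of `V` attached to a polynomial `p`: the sum of `ker p(h)` and `ker p(h⁻¹)`. For
an irreducible factor `p` of the minimal polynomial of `h`, either the two kernels coincide,
and then (if `p ≠ X ∓ 1`) the block is a Hermitian space over the field `F[X]/(p)`, or the sum
is direct and equal to `X ⊕ X*` with `X = ker p(h)`. -/
def block (h : Q.IsometryEquiv Q) (p : F[X]) : Submodule F V :=
  LinearMap.ker (aeval (toEnd h) p) ⊔ LinearMap.ker (aeval (toEnd h.symm) p)

/-- The set `{V₁, …, V_m}` of the blocks other than `V₊` and `V₋`: those attached to the monic
irreducible factors `p ≠ X - 1, X + 1` of the minimal polynomial of `h`. -/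
def properBlocks (h : Q.IsometryEquiv Q) : Set (Submodule F V) :=
  {W | ∃ p : F[X], p.Monic ∧ Irreducible p ∧ p ∣ minpoly F (toEnd h) ∧
    p ≠ X - 1 ∧ p ≠ X + 1 ∧ W = block h p}

/-- The family `V₁, …, V_m, V₊, V₋` of subspaces of `V`. -/
def allBlocks (h : Q.IsometryEquiv Q) : properBlocks h ⊕ Bool → Submodule F V
  | Sum.inl W => (W : Submodule F V)
  | Sum.inr true => plusSpace h
  | Sum.inr false => minusSpace h

/-- `V` is the orthogonal direct sum of the subspaces `W i`. -/
def IsOrthogonalDirectSum {κ : Type*} (Q : QuadraticForm F V) (W : κ → Submodule F V) : Prop :=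
  iSupIndep W ∧ iSup W = ⊤ ∧
    ∀ i j, i ≠ j → ∀ x ∈ W i, ∀ y ∈ W j, QuadraticMap.polar Q x y = 0

/-- `β ∈ O(V)` maps the subspace `W` to itself, and the restriction of `β` to `W` has
determinant `d`. -/
def HasDetOn (β : Q.IsometryEquiv Q) (W : Submodule F V) (d : F) : Prop :=
  ∃ hW : ∀ x ∈ W, toEnd β x ∈ W, LinearMap.det ((toEnd β).restrict hW) = d

/-- `β = (β₁, …, β_m, β₊, β₋)` with respect to the decomposition attached to `h`, and
`det β_i = (-1)^{k_i}`, `det β₊ = δ`, `det β₋ = (-1)^{k₋}`, where `dim V_i = 2 k_i` and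
`dim V₋ = 2 k₋`. -/
def HasBlockDets (h β : Q.IsometryEquiv Q) (δ : ℤˣ) : Prop :=
  (∀ W ∈ properBlocks h, HasDetOn β W ((-1) ^ halfDim (Module.finrank F W))) ∧
  HasDetOn β (plusSpace h) ((δ : ℤ) : F) ∧
  HasDetOn β (minusSpace h) ((-1) ^ halfDim (Module.finrank F (minusSpace h)))

end

end GeneralPin

end

/-! Write `h = P(g)`. A semisimple isometry is inverted by an isometric involution `β` that is the
identity on `ker (h - h⁻¹) = V₊ ⊕ V₋` (`exists_inverting_involution`). It is assembled orthogonally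
from nondegenerate cyclic pieces, where `p(h) w ↦ p(h⁻¹) w` does the job. Then `ρ = hβ` is also an
isometric involution and `h = ρβ`.

The operator `N = h - h⁻¹` anticommutes with `β` and with `ρ`, which balances their eigenspaces away
from `ker N`: if `s` and `s'` are the dimensions of the `-1`-eigenspaces of `β` and `ρ`, then `2s +
dim V₊ + dim V₋ = n` and `s' = s + dim V₋`. An involution lifts to a product `u` of pairwise
orthogonal anisotropic vectors, as many as the dimension of its `-1`-eigenspace, so `u* = ±u` and
`α(u) = ±u` with explicit signs (`exists_lift_involution`).

The kernel of `P` consists of scalars (`mem_range_algebraMap_of_twisted_central`). Hence `g = a u'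
u`, with `u'` and `u` lifting `ρ` and `β`, and `g* = ± a u u'`. Conjugation by `u⁻¹` turns this into
`± g`, and also `α(g) = (-1) ^ dim V₋ g` (`exists_conj_canonicalInvolution`).

It remains to correct the sign. A vector of `V₊` conjugates `g` to `α(g)` and one of `V₋` to
`-α(g)`. If `g` is even, the sign is `(-1) ^ k₋`, and an element over `V₋` of determinant `(-1) ^
k₋` cancels it, while vectors of `V₊` commute with `g` and leave `δ` free. If `g` is odd, a vector
of `V₊` changes the sign; when `V₊ = 0`, the factor `sign(g) ^ (k + 1)` in `σ_V` makes the sign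
right already. On each `V_i` the operator `N` is bijective, so `β` has equal eigenspaces there and
determinant `(-1) ^ k_i`. -/

open CliffordAlgebra Polynomial

noncomputable section

namespace GeneralPin

/-! ### Inverting a semisimple isometry by an isometric involution. -/

section LinearAlgebra

variable {F : Type*} [Field F] {V : Type*} [AddCommGroup V] [Module F V]

/-- Polynomials in `T` and `S` are intertwined by any map that intertwines `T` and `S`. -/
theorem aeval_intertwine {W : Type*} [AddCommGroup W] [Module F W] {f : V →ₗ[F] W}
    {T : Module.End F V} {S : Module.End F W} (hf : ∀ x, f (T x) = S (f x)) (p : F[X]) (x : V) :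
    f (aeval T p x) = aeval S p (f x) := by
  have h : ∀ n : ℕ, ∀ x, f ((T ^ n) x) = (S ^ n) (f x) := by
    intro n
    induction n with
    | zero => simp
    | succ n ih => intro x; rw [pow_succ, pow_succ, Module.End.mul_apply, Module.End.mul_apply, ih, hf]
  induction p using Polynomial.induction_on' with
  | add p q hp hq => simp [hp, hq]
  | monomial n a => simp [aeval_monomial, h]

theorem bilin_aeval {B : LinearMap.BilinForm F V} {T S : Module.End F V}
    (adj : ∀ x y, B (T x) y = B x (S y)) (p : F[X]) (x y : V) :
    B (aeval T p x) y = B x (aeval S p y) := by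
  have h : ∀ n : ℕ, ∀ x y, B ((T ^ n) x) y = B x ((S ^ n) y) := by
    intro n
    induction n with
    | zero => simp
    | succ n ih =>
      intro x y
      rw [pow_succ, pow_succ', Module.End.mul_apply, Module.End.mul_apply, ih, adj]
  induction p using Polynomial.induction_on' with
  | add p q hp hq => simp [hp, hq]
  | monomial n a => simp [aeval_monomial, h]

theorem aeval_mem {T : Module.End F V} {W : Submodule F V} (hW : ∀ x ∈ W, T x ∈ W) (p : F[X])
    {x : V} (hx : x ∈ W) : aeval T p x ∈ W := by
  have h : ∀ n : ℕ, (T ^ n) x ∈ W := by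
    intro n
    induction n with
    | zero => simpa
    | succ n ih => rw [pow_succ', Module.End.mul_apply]; exact hW _ ih
  induction p using Polynomial.induction_on' with
  | add p q hp hq => simpa using W.add_mem hp hq
  | monomial n a => simpa [aeval_monomial] using W.smul_mem a (h n)

theorem aeval_mul_apply_comm (T : Module.End F V) (p q : F[X]) (x : V) :
    aeval T p (aeval T q x) = aeval T q (aeval T p x) := by
  rw [← Module.End.mul_apply, ← Module.End.mul_apply, ← map_mul, ← map_mul, mul_comm]

theorem inverse_mem [FiniteDimensional F V] {T S : Module.End F V} (hST : S * T = 1)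
    {W : Submodule F V} (hW : ∀ x ∈ W, T x ∈ W) {x : V} (hx : x ∈ W) : S x ∈ W := by
  have hl : ∀ y, S (T y) = y := fun y => by rw [← Module.End.mul_apply, hST]; rfl
  have hinj : Function.Injective (T.restrict hW) := by
    intro a b hab
    have := congrArg (fun z : W => S z) hab
    simpa [hl] using this
  obtain ⟨y, hy⟩ := (LinearMap.injective_iff_surjective.1 hinj) ⟨x, hx⟩
  have : T y = x := congrArg Subtype.val hy
  rw [← this, hl]
  exact y.2

theorem isCompl_ker_of_involution {β : Module.End F V} (hβ : ∀ x, β (β x) = x)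
    (h2 : (2 : F) ≠ 0) : IsCompl (LinearMap.ker (β - 1)) (LinearMap.ker (β + 1)) := by
  refine ⟨Submodule.disjoint_def.2 fun x hx hx' => ?_, codisjoint_iff.2 (eq_top_iff.2 ?_)⟩
  · have h1 : β x - x = 0 := hx
    have h3 : β x + x = 0 := hx'
    have : (2 : F) • x = 0 := by rw [two_smul, ← sub_eq_zero.2 (h3.trans h1.symm)]; abel
    exact (smul_eq_zero.1 this).resolve_left h2
  · intro x _
    have : x = (2 : F)⁻¹ • (x + β x) + (2 : F)⁻¹ • (x - β x) := by
      rw [← smul_add, add_add_sub_cancel, ← two_smul F, smul_smul, inv_mul_cancel₀ h2, one_smul]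
    rw [this]
    refine Submodule.add_mem_sup (Submodule.smul_mem _ _ ?_) (Submodule.smul_mem _ _ ?_)
    · change β (x + β x) - (x + β x) = 0
      rw [map_add, hβ]; abel
    · change β (x - β x) + (x - β x) = 0
      rw [map_sub, hβ]; abel

/-- `β` restricts to an isometric involution of `W` that inverts `h`. -/
structure IsInvertingOn (B : LinearMap.BilinForm F V) (h β : Module.End F V) (W : Submodule F V) :
    Prop where
  mem : ∀ x ∈ W, β x ∈ W
  invol : ∀ x ∈ W, β (β x) = x
  isom : ∀ x ∈ W, ∀ y ∈ W, B (β x) (β y) = B x y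
  inv : ∀ x ∈ W, h (β (h x)) = β x

variable [FiniteDimensional F V] {B : LinearMap.BilinForm F V} {h k : Module.End F V}

/-- Since `C` is nondegenerate, there is a projection `π` onto `C` along its orthogonal complement,
which kills `D`. The map `γπ + δ(1 - π)` then agrees with `γ` on `C` and with `δ` on `D`. -/
theorem IsInvertingOn.glue (hs : B.IsSymm) {γ δ : Module.End F V}
    {C D : Submodule F V} (hC : IsInvertingOn B h γ C) (hD : IsInvertingOn B h δ D)
    (hCh : ∀ x ∈ C, h x ∈ C) (hDh : ∀ x ∈ D, h x ∈ D)
    (hdis : Disjoint C (B.orthogonal C)) (hCD : D ≤ B.orthogonal C) :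
    ∃ β, IsInvertingOn B h β (C ⊔ D) ∧ (∀ x ∈ C, β x = γ x) ∧ (∀ x ∈ D, β x = δ x) := by
  have hc : IsCompl C (B.orthogonal C) :=
    (LinearMap.BilinForm.isCompl_orthogonal_iff_disjoint hs.isRefl).2 hdis
  let π : Module.End F V := C.subtype ∘ₗ C.projectionOnto _ hc
  have hπC : ∀ x ∈ C, π x = x := fun x hx => by
    have := Submodule.projectionOnto_apply_left hc ⟨x, hx⟩
    simp [π, this]
  have hπD : ∀ x ∈ D, π x = 0 := fun x hx => by
    have := Submodule.projectionOnto_apply_right hc ⟨x, hCD hx⟩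
    simp [π, this]
  let β : Module.End F V := γ ∘ₗ π + δ ∘ₗ (1 - π)
  have hβC : ∀ x ∈ C, β x = γ x := fun x hx => by simp [β, hπC x hx]
  have hβD : ∀ x ∈ D, β x = δ x := fun x hx => by simp [β, hπD x hx]
  have o1 : ∀ x ∈ C, ∀ y ∈ D, B x y = 0 := fun x hx y hy => hCD hy x hx
  have o2 : ∀ x ∈ D, ∀ y ∈ C, B x y = 0 := fun x hx y hy => by rw [hs.eq]; exact o1 y hy x hx
  refine ⟨β, ⟨?_, ?_, ?_, ?_⟩, hβC, hβD⟩
  · intro x hx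
    obtain ⟨c, hc, d, hd, rfl⟩ := Submodule.mem_sup.1 hx
    rw [map_add, hβC c hc, hβD d hd]
    exact Submodule.add_mem_sup (hC.mem c hc) (hD.mem d hd)
  · intro x hx
    obtain ⟨c, hc, d, hd, rfl⟩ := Submodule.mem_sup.1 hx
    rw [map_add, hβC c hc, hβD d hd, map_add, hβC _ (hC.mem c hc), hβD _ (hD.mem d hd),
      hC.invol c hc, hD.invol d hd]
  · intro x hx y hy
    obtain ⟨c, hc, d, hd, rfl⟩ := Submodule.mem_sup.1 hx
    obtain ⟨c', hc', d', hd', rfl⟩ := Submodule.mem_sup.1 hy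
    rw [map_add β, map_add β, hβC c hc, hβD d hd, hβC c' hc', hβD d' hd']
    simp only [map_add, LinearMap.add_apply]
    rw [hC.isom c hc c' hc', hD.isom d hd d' hd', o1 _ (hC.mem c hc) _ (hD.mem d' hd'),
      o2 _ (hD.mem d hd) _ (hC.mem c' hc'), o1 c hc d' hd', o2 d hd c' hc']
  · intro x hx
    obtain ⟨c, hc, d, hd, rfl⟩ := Submodule.mem_sup.1 hx
    rw [map_add, map_add, hβC _ (hCh c hc), hβD _ (hDh d hd), map_add, hC.inv c hc, hD.inv d hd,
      map_add, hβC c hc, hβD d hd]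

/-- A nondegenerate cyclic module carries the involution `p(h) w ↦ p(h⁻¹) w`. -/
theorem exists_invertingOn_cyclic (hs : B.IsSymm) (hk : h * k = 1) (kh : k * h = 1)
    (adj : ∀ x y, B (h x) y = B x (k y)) (w : V) {C : Submodule F V}
    (hC : ∀ x, x ∈ C ↔ ∃ p : F[X], aeval h p w = x) (hdis : Disjoint C (B.orthogonal C)) :
    ∃ β, IsInvertingOn B h β C := by
  have hr : ∀ y, h (k y) = y := fun y => by rw [← Module.End.mul_apply, hk]; rfl
  have hl : ∀ y, k (h y) = y := fun y => by rw [← Module.End.mul_apply, kh]; rfl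
  have adj' : ∀ x y, B (k x) y = B x (h y) := fun x y => by rw [← hl y, ← adj, hr, hl]
  have hCh : ∀ x ∈ C, h x ∈ C := by
    intro x hx
    obtain ⟨p, rfl⟩ := (hC x).1 hx
    exact (hC _).2 ⟨X * p, by simp⟩
  have hCk : ∀ x ∈ C, k x ∈ C := fun x hx => inverse_mem kh hCh hx
  have hw : w ∈ C := (hC w).2 ⟨1, by simp⟩
  have comm : ∀ p q : F[X], ∀ x, aeval h p (aeval k q x) = aeval k q (aeval h p x) := by
    intro p q x
    refine aeval_intertwine (f := aeval (R := F) h p) (fun x => ?_) q x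
    exact (aeval_intertwine (f := k) (fun x => by rw [hl, hr]) p x).symm
  have hψ : ∀ p : F[X], aeval k p w ∈ C := fun p => aeval_mem hCk p hw
  -- Nondegeneracy of `C` in usable form: identities in `C` may be tested against the vectors `r(h)
  -- w`.
  have zero_of : ∀ x ∈ C, (∀ r : F[X], B (aeval h r w) x = 0) → x = 0 := by
    intro x hx hx0
    refine (Submodule.disjoint_def.1 hdis) x hx fun y hy => ?_
    obtain ⟨r, rfl⟩ := (hC y).1 hy
    exact hx0 r
  have e1 : ∀ r p : F[X], B (aeval h r w) (aeval k p w) = B (aeval h r (aeval h p w)) w := by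
    intro r p
    rw [← bilin_aeval adj, aeval_mul_apply_comm]
  let φ : F[X] →ₗ[F] V := (LinearMap.applyₗ w) ∘ₗ (aeval (R := F) h).toLinearMap
  let ψ : F[X] →ₗ[F] V := (LinearMap.applyₗ w) ∘ₗ (aeval (R := F) k).toLinearMap
  have hφ : ∀ p, φ p = aeval h p w := fun p => rfl
  have hψ' : ∀ p, ψ p = aeval k p w := fun p => rfl
  -- This is the well-definedness of `p(h) w ↦ p(h⁻¹) w`: `B(r(h) w, p(h⁻¹) w) = B(r(h) p(h) w, w)`
  -- vanishes for all `r` once `p(h) w = 0`.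
  have key : ∀ p : F[X], φ p = 0 → ψ p = 0 := by
    intro p hp
    refine zero_of (ψ p) (hψ p) fun r => ?_
    rw [hψ', e1, ← hφ p, hp]; simp
  obtain ⟨σ, hσ⟩ := LinearMap.exists_rightInverse_of_surjective φ.rangeRestrict
    (LinearMap.range_rangeRestrict φ)
  obtain ⟨β, hβ⟩ := LinearMap.exists_extend (ψ ∘ₗ σ)
  have hβφ : ∀ p : F[X], β (aeval h p w) = aeval k p w := by
    intro p
    have h1 := LinearMap.congr_fun hβ ⟨φ p, LinearMap.mem_range_self φ p⟩
    have h2 := congrArg Subtype.val (LinearMap.congr_fun hσ ⟨φ p, LinearMap.mem_range_self φ p⟩)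
    have h3 : φ (σ ⟨φ p, LinearMap.mem_range_self φ p⟩) = φ p := h2
    have h4 := key (σ ⟨φ p, LinearMap.mem_range_self φ p⟩ - p) (by rw [map_sub, h3, sub_self])
    rw [map_sub, sub_eq_zero] at h4
    exact h1.trans h4
  refine ⟨β, ⟨?_, ?_, ?_, ?_⟩⟩
  · intro x hx
    obtain ⟨p, rfl⟩ := (hC x).1 hx
    rw [hβφ]; exact hψ p
  · intro x hx
    obtain ⟨p, rfl⟩ := (hC x).1 hx
    rw [hβφ]
    obtain ⟨q, hq⟩ := (hC _).1 (hψ p)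
    rw [← hq, hβφ, ← sub_eq_zero]
    refine zero_of _ (C.sub_mem (hψ q) hx) fun r => ?_
    rw [map_sub, e1, hq, comm, bilin_aeval adj', sub_self]
  · intro x hx y hy
    obtain ⟨p, rfl⟩ := (hC x).1 hx
    obtain ⟨q, rfl⟩ := (hC y).1 hy
    rw [hβφ, hβφ, bilin_aeval adj', comm, ← bilin_aeval adj, hs.eq]
  · intro x hx
    obtain ⟨p, rfl⟩ := (hC x).1 hx
    have : h (aeval h p w) = aeval h (X * p) w := by simp
    rw [this, hβφ, hβφ]
    simp [hr]

/-- Induction on `dim W`, splitting off a nonzero nondegenerate cyclic subspace. The cyclic span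
`C₀` of an anisotropic vector `w` may be degenerate, but its radical is invariant, so semisimplicity
gives an invariant complement `D` of the radical. The component of `w` in `D` generates the required
subspace. -/
theorem exists_invertingOn (hs : B.IsSymm) (hk : h * k = 1) (kh : k * h = 1)
    (adj : ∀ x y, B (h x) y = B x (k y)) (ss : h.IsSemisimple) (h2 : (2 : F) ≠ 0)
    (W : Submodule F V) (hW : ∀ x ∈ W, h x ∈ W) (hdis : Disjoint W (B.orthogonal W)) :
    ∃ β, IsInvertingOn B h β W := by
  induction hn : Module.finrank F W using Nat.strong_induction_on generalizing W with
  | _ n ih =>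
  by_cases hbot : W = ⊥
  · subst hbot
    refine ⟨0, ⟨?_, ?_, ?_, ?_⟩⟩ <;> simp
  obtain ⟨w, hwW, hw⟩ : ∃ w ∈ W, B w w ≠ 0 := by
    by_contra! hcon
    refine hbot (eq_bot_iff.2 fun x hx => (Submodule.disjoint_def.1 hdis) x hx fun y hy => ?_)
    have h1 := hcon (y + x) (W.add_mem hy hx)
    simp only [map_add, LinearMap.add_apply, hcon x hx, hcon y hy, hs.eq x y] at h1
    have h1' : 2 * B y x = 0 := by linear_combination h1
    exact (mul_eq_zero.1 h1').resolve_left h2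
  have hstab : ∀ v : V, ∃ C : Submodule F V,
      (∀ x, x ∈ C ↔ ∃ p : F[X], aeval h p v = x) ∧ ∀ x ∈ C, h x ∈ C := by
    intro v
    refine ⟨LinearMap.range ((LinearMap.applyₗ v) ∘ₗ (aeval (R := F) h).toLinearMap),
      fun x => Iff.rfl, ?_⟩
    rintro _ ⟨p, rfl⟩
    exact ⟨X * p, by simp⟩
  have horth : ∀ C : Submodule F V, (∀ x ∈ C, h x ∈ C) →
      ∀ x ∈ B.orthogonal C, h x ∈ B.orthogonal C := by
    intro C hC x hx y hy
    change B y (h x) = 0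
    rw [hs.eq, adj, hs.eq]
    exact hx _ (inverse_mem kh hC hy)
  obtain ⟨C₀, hC₀, hC₀h⟩ := hstab w
  have hwC₀ : w ∈ C₀ := (hC₀ w).2 ⟨1, by simp⟩
  obtain ⟨D, hD, hRD⟩ := (Module.End.isSemisimple_iff.1 ss) (C₀ ⊓ B.orthogonal C₀)
    (fun x hx => ⟨hC₀h x hx.1, horth C₀ hC₀h x hx.2⟩)
  obtain ⟨w₁, hw₁, w₂, hw₂, hww⟩ := Submodule.mem_sup.1
    (hRD.sup_eq_top ▸ Submodule.mem_top : w ∈ C₀ ⊓ B.orthogonal C₀ ⊔ D)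
  obtain ⟨C, hC, hCh⟩ := hstab w₂
  have hw₂C : w₂ ∈ C := (hC w₂).2 ⟨1, by simp⟩
  have hw₂C₀ : w₂ ∈ C₀ := by
    have : w₂ = w - w₁ := by rw [← hww]; abel
    rw [this]; exact C₀.sub_mem hwC₀ hw₁.1
  have hC₀W : C₀ ≤ W := by
    intro x hx
    obtain ⟨p, rfl⟩ := (hC₀ x).1 hx
    exact aeval_mem hW p hwW
  have hCC₀ : C ≤ C₀ := by
    intro x hx
    obtain ⟨p, rfl⟩ := (hC x).1 hx
    exact aeval_mem hC₀h p hw₂C₀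
  -- A vector `x` of the radical of `C` is orthogonal to `q(h) w₂` by definition and to `q(h) w₁`
  -- because that lies in the radical of `C₀`. So `x` is in the radical of `C₀` and also in its
  -- complement `D`.
  have hCdis : Disjoint C (B.orthogonal C) := by
    refine Submodule.disjoint_def.2 fun x hx hx' => ?_
    have hxD : x ∈ D := by
      obtain ⟨p, rfl⟩ := (hC x).1 hx
      exact aeval_mem hD p hw₂
    refine (Submodule.disjoint_def.1 hRD.disjoint) x ⟨hCC₀ hx, fun y hy => ?_⟩ hxD
    obtain ⟨q, rfl⟩ := (hC₀ y).1 hy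
    have h1 : aeval h q w₁ ∈ B.orthogonal C₀ := aeval_mem (horth C₀ hC₀h) q hw₁.2
    have h2 : B x (aeval h q w₁) = 0 := h1 x (hCC₀ hx)
    have h3 : B (aeval h q w₂) x = 0 := hx' _ ((hC _).2 ⟨q, rfl⟩)
    change B (aeval h q w) x = 0
    rw [← hww, map_add, map_add, LinearMap.add_apply, h3, hs.eq, h2, add_zero]
  -- Otherwise `w` would lie in the radical of `C₀` and be isotropic.
  have hw₂0 : w₂ ≠ 0 := by
    rintro rfl
    rw [add_zero] at hww
    subst hww
    exact hw (hw₁.2 _ hwC₀)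
  have hcompl : IsCompl C (B.orthogonal C) :=
    (LinearMap.BilinForm.isCompl_orthogonal_iff_disjoint hs.isRefl).2 hCdis
  have hsup : C ⊔ (W ⊓ B.orthogonal C) = W := by
    refine le_antisymm (sup_le (hCC₀.trans hC₀W) inf_le_left) fun x hx => ?_
    obtain ⟨c, hc, y, hy, rfl⟩ := Submodule.mem_sup.1
      (hcompl.sup_eq_top ▸ Submodule.mem_top : x ∈ C ⊔ B.orthogonal C)
    refine Submodule.add_mem_sup hc ⟨?_, hy⟩
    have := W.sub_mem hx (hC₀W (hCC₀ hc))
    rwa [add_sub_cancel_left] at this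
  have hlt : W ⊓ B.orthogonal C < W := by
    refine lt_of_le_of_ne inf_le_left fun heq => hw₂0 ?_
    have : w₂ ∈ W ⊓ B.orthogonal C := heq.ge (hC₀W hw₂C₀)
    exact (Submodule.disjoint_def.1 hCdis) _ hw₂C this.2
  have hdis' : Disjoint (W ⊓ B.orthogonal C) (B.orthogonal (W ⊓ B.orthogonal C)) := by
    refine Submodule.disjoint_def.2 fun x hx hx' => (Submodule.disjoint_def.1 hdis) x hx.1 ?_
    intro y hy
    rw [← hsup] at hy
    obtain ⟨c, hc, d, hd, rfl⟩ := Submodule.mem_sup.1 hy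
    have h1 : B c x = 0 := hx.2 c hc
    have h2 : B d x = 0 := hx' d hd
    change B (c + d) x = 0
    rw [map_add, LinearMap.add_apply, h1, h2, add_zero]
  have hinv' : ∀ x ∈ W ⊓ B.orthogonal C, h x ∈ W ⊓ B.orthogonal C :=
    fun x hx => ⟨hW x hx.1, horth C hCh x hx.2⟩
  obtain ⟨δ, hδ⟩ := ih _ (hn ▸ Submodule.finrank_lt_finrank_of_lt hlt) _ hinv' hdis' rfl
  obtain ⟨γ, hγ⟩ := exists_invertingOn_cyclic hs hk kh adj w₂ hC hCdis
  obtain ⟨β, hβ, -⟩ := hγ.glue hs hδ hCh hinv' hCdis inf_le_right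
  exact ⟨β, hsup ▸ hβ⟩

/-- If `T` commutes with a semisimple `h` and preserves every `h`-invariant subspace, then the kernel
and the range of `T` are complementary. -/
theorem isCompl_ker_range (ss : h.IsSemisimple) {T : Module.End F V} (hT : ∀ x, h (T x) = T (h x))
    (hinv : ∀ W : Submodule F V, (∀ x ∈ W, h x ∈ W) → ∀ x ∈ W, T x ∈ W) :
    IsCompl (LinearMap.ker T) (LinearMap.range T) := by
  obtain ⟨D, hD, hKD⟩ := (Module.End.isSemisimple_iff.1 ss) (LinearMap.ker T) (fun x hx => by
    rw [Submodule.mem_comap, LinearMap.mem_ker, ← hT, LinearMap.mem_ker.1 hx, map_zero])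
  -- As `T` preserves `D` and kills the other summand, its range lies in `D`; rank-nullity then
  -- gives complementarity.
  have hle : LinearMap.range T ≤ D := by
    rintro _ ⟨y, rfl⟩
    obtain ⟨a, ha, d, hd, rfl⟩ := Submodule.mem_sup.1
      (hKD.sup_eq_top ▸ Submodule.mem_top : y ∈ LinearMap.ker T ⊔ D)
    rw [map_add, LinearMap.mem_ker.1 ha, zero_add]
    exact hinv D hD d hd
  have hdis : Disjoint (LinearMap.ker T) (LinearMap.range T) := hKD.disjoint.mono_right hle
  refine ⟨hdis, codisjoint_iff.2 (Submodule.eq_top_of_disjoint _ _ ?_ hdis)⟩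
  rw [add_comm]
  exact (LinearMap.finrank_range_add_finrank_ker T).ge

theorem isCompl_ker_range_sub (hk : h * k = 1) (kh : k * h = 1) (ss : h.IsSemisimple) :
    IsCompl (LinearMap.ker (h - k)) (LinearMap.range (h - k)) := by
  have hr : ∀ y, h (k y) = y := fun y => by rw [← Module.End.mul_apply, hk]; rfl
  have hl : ∀ y, k (h y) = y := fun y => by rw [← Module.End.mul_apply, kh]; rfl
  refine isCompl_ker_range ss (fun x => by simp [hr, hl]) fun W hW x hx => ?_
  exact W.sub_mem (hW x hx) (inverse_mem kh hW hx)

/-- A semisimple isometry `h` is inverted by an isometric involution that is the identity on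
`ker (h - h⁻¹)`. -/
theorem exists_inverting_involution (hB : B.Nondegenerate) (hs : B.IsSymm) (hk : h * k = 1)
    (kh : k * h = 1) (adj : ∀ x y, B (h x) y = B x (k y)) (ss : h.IsSemisimple)
    (h2 : (2 : F) ≠ 0) :
    ∃ β : Module.End F V, (∀ x, β (β x) = x) ∧ (∀ x y, B (β x) (β y) = B x y) ∧
      (∀ x, h (β (h x)) = β x) ∧ ∀ x, h x = k x → β x = x := by
  have hr : ∀ y, h (k y) = y := fun y => by rw [← Module.End.mul_apply, hk]; rfl
  have hl : ∀ y, k (h y) = y := fun y => by rw [← Module.End.mul_apply, kh]; rfl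
  have adj' : ∀ x y, B (k x) y = B x (h y) := fun x y => by rw [← hl y, ← adj, hr, hl]
  have hc := isCompl_ker_range_sub hk kh ss
  set K := LinearMap.ker (h - k) with hK
  set R := LinearMap.range (h - k) with hR
  have hmK : ∀ x, x ∈ K ↔ h x = k x := fun x => by
    rw [hK, LinearMap.mem_ker, LinearMap.sub_apply, sub_eq_zero]
  have hKh : ∀ x ∈ K, h x ∈ K := fun x hx => by
    rw [hmK] at hx ⊢; rw [hl, hx, hr]
  have hRh : ∀ x ∈ R, h x ∈ R := by
    rintro _ ⟨y, rfl⟩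
    exact ⟨h y, by simp [hl, hr]⟩
  have hRK : R ≤ B.orthogonal K := by
    rintro _ ⟨y, rfl⟩ x hx
    change B x ((h - k) y) = 0
    rw [LinearMap.sub_apply, map_sub, ← adj, ← adj', (hmK x).1 hx, sub_self]
  have hnd : ∀ x, (∀ y ∈ K, B y x = 0) → (∀ y ∈ R, B y x = 0) → x = 0 := by
    intro x h1 h2
    refine hB.2 x fun y => ?_
    obtain ⟨a, ha, b, hb, rfl⟩ := Submodule.mem_sup.1
      (hc.sup_eq_top ▸ Submodule.mem_top : y ∈ K ⊔ R)
    rw [map_add, LinearMap.add_apply, h1 a ha, h2 b hb, add_zero]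
  have hKd : Disjoint K (B.orthogonal K) := by
    refine Submodule.disjoint_def.2 fun x hx hx' => hnd x hx' fun y hy => ?_
    rw [hs.eq]; exact hRK hy x hx
  have hRd : Disjoint R (B.orthogonal R) :=
    Submodule.disjoint_def.2 fun x hx hx' => hnd x (fun y hy => hRK hx y hy) hx'
  obtain ⟨δ, hδ⟩ := exists_invertingOn hs hk kh adj ss h2 R hRh hRd
  -- On `K` one has `h = h⁻¹`, so the identity already inverts `h`.
  have hγ : IsInvertingOn B h 1 K := by
    refine ⟨fun x hx => hx, fun x hx => rfl, fun x hx y hy => rfl, fun x hx => ?_⟩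
    change h (h x) = x
    rw [(hmK x).1 hx, hr]
  obtain ⟨β, hβ, hβK, -⟩ := hγ.glue hs hδ hKh hRh hKd hRK
  have ht : ∀ x, x ∈ K ⊔ R := fun x => hc.sup_eq_top ▸ Submodule.mem_top
  exact ⟨β, fun x => hβ.invol x (ht x), fun x y => hβ.isom x (ht x) y (ht y),
    fun x => hβ.inv x (ht x), fun x hx => hβK x ((hmK x).2 hx)⟩

theorem det_of_involution {β : Module.End F V} (hβ : ∀ x, β (β x) = x) (h2 : (2 : F) ≠ 0) :
    LinearMap.det β = (-1) ^ Module.finrank F (LinearMap.ker (β + 1)) := by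
  have hc := isCompl_ker_of_involution hβ h2
  have h1 : β = (Submodule.prodEquivOfIsCompl _ _ hc : _ →ₗ[F] V) ∘ₗ
      (LinearMap.prodMap (LinearMap.id : Module.End F (LinearMap.ker (β - 1)))
        ((-1 : F) • (LinearMap.id : Module.End F (LinearMap.ker (β + 1))))) ∘ₗ
      ((Submodule.prodEquivOfIsCompl _ _ hc).symm : V →ₗ[F] _) := by
    refine LinearMap.ext fun x => ?_
    obtain ⟨⟨a, b⟩, rfl⟩ := (Submodule.prodEquivOfIsCompl _ _ hc).surjective x
    have ha : β a - a = 0 := a.2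
    have hb : β b + b = 0 := b.2
    simp [sub_eq_zero.1 ha, eq_neg_of_add_eq_zero_left hb]
  conv_lhs => rw [h1]
  rw [LinearMap.det_conj, LinearMap.det_prodMap, LinearMap.det_id, LinearMap.det_smul,
    LinearMap.det_id, one_mul, mul_one]

/-- The eigenspaces of an involution that anticommutes with `N` have the same dimension, up to the
contribution of `ker N`. -/
theorem finrank_eigenspaces_of_anticommute {β N : Module.End F V} (hβ : ∀ x, β (β x) = x)
    (hN : ∀ x, β (N x) = -N (β x)) (hd : Disjoint (LinearMap.ker N) (LinearMap.range N))
    (h2 : (2 : F) ≠ 0) :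
    2 * Module.finrank F (LinearMap.ker (β + 1)) +
      Module.finrank F ↥(LinearMap.ker (β - 1) ⊓ LinearMap.ker N) =
    Module.finrank F V + Module.finrank F ↥(LinearMap.ker (β + 1) ⊓ LinearMap.ker N) := by
  -- The image `N E` meets `ker N` trivially, so `N E` and `E' ∩ ker N` are independent in `E'`.
  -- Applied to both eigenspaces, which `N` interchanges, the two inequalities combine to an
  -- equality.
  have key : ∀ E E' : Submodule F V, (∀ x ∈ E, N x ∈ E') →
      Module.finrank F E + Module.finrank F ↥(E' ⊓ LinearMap.ker N) ≤
        Module.finrank F E' + Module.finrank F ↥(E ⊓ LinearMap.ker N) := by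
    intro E E' hE
    have h1 := LinearMap.finrank_range_add_finrank_ker (N.domRestrict E)
    have h3 : Module.finrank F (LinearMap.ker (N.domRestrict E)) =
        Module.finrank F ↥(E ⊓ LinearMap.ker N) := by
      rw [LinearMap.ker_domRestrict, inf_comm, ← Submodule.finrank_map_subtype_eq,
        Submodule.map_comap_subtype, inf_comm]
    have h4 : LinearMap.range (N.domRestrict E) ⊔ (E' ⊓ LinearMap.ker N) ≤ E' := by
      refine sup_le ?_ inf_le_left
      rintro _ ⟨x, rfl⟩
      exact hE x x.2
    have h5 : LinearMap.range (N.domRestrict E) ⊓ (E' ⊓ LinearMap.ker N) = ⊥ := by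
      refine eq_bot_iff.2 ?_
      rintro _ ⟨⟨x, rfl⟩, hx⟩
      exact (Submodule.disjoint_def.1 hd) _ hx.2 ⟨x, rfl⟩
    have h6 := Submodule.finrank_sup_add_finrank_inf_eq (LinearMap.range (N.domRestrict E))
      (E' ⊓ LinearMap.ker N)
    have h7 := Submodule.finrank_mono h4
    rw [h5, finrank_bot] at h6
    omega
  have hc := Submodule.finrank_add_eq_of_isCompl (isCompl_ker_of_involution hβ h2)
  have k1 := key (LinearMap.ker (β - 1)) (LinearMap.ker (β + 1)) (fun x hx => by
    have : β x - x = 0 := hx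
    change β (N x) + N x = 0
    rw [hN, sub_eq_zero.1 this, neg_add_cancel])
  have k2 := key (LinearMap.ker (β + 1)) (LinearMap.ker (β - 1)) (fun x hx => by
    have : β x + x = 0 := hx
    change β (N x) - N x = 0
    rw [hN, eq_neg_of_add_eq_zero_left this, map_neg, neg_neg, sub_self])
  omega

end LinearAlgebra

end GeneralPin

end

noncomputable section

namespace GeneralPin

/-! ### Kernels of polynomials in an operator and in its inverse. -/

section Kernels

variable {F : Type*} [Field F] {V : Type*} [AddCommGroup V] [Module F V]
variable {T S : Module.End F V}

/-- Multiplication by `T ^ N` clears the negative powers of `T` in `q(T⁻¹)`. With `N = natDegree q`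
this trades `q(T⁻¹)` for the reversed polynomial at `T`. -/
theorem aeval_reflect (hTS : T * S = 1) (N : ℕ) (q : F[X]) (hq : q.natDegree ≤ N) :
    aeval T (reflect N q) = T ^ N * aeval S q := by
  have hpow : ∀ n : ℕ, T ^ n * S ^ n = 1 := by
    intro n
    induction n with
    | zero => simp
    | succ n ih => rw [pow_succ, pow_succ', mul_assoc, ← mul_assoc T, hTS, one_mul, ih]
  refine induction_with_natDegree_le
    (fun q => aeval T (reflect N q) = T ^ N * aeval S q) N ?_ ?_ ?_ q hq
  · simp
  · intro n r _ hn
    have h1 : T ^ N * S ^ n = T ^ (N - n) := by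
      conv_lhs => rw [← Nat.sub_add_cancel hn, pow_add, mul_assoc, hpow, mul_one]
    rw [reflect_C_mul_X_pow, revAt_le hn]
    simp only [map_mul, aeval_C, map_pow, aeval_X]
    rw [← mul_assoc, ← Algebra.commutes, mul_assoc, h1]
  · intro f g _ _ hf hg
    rw [reflect_add, map_add, map_add, mul_add, hf, hg]

theorem ker_aeval_le_of_dvd_reverse (hTS : T * S = 1) (hST : S * T = 1) {p q : F[X]}
    (hpq : p ∣ q.reverse) : LinearMap.ker (aeval T p) ≤ LinearMap.ker (aeval S q) := by
  intro x hx
  obtain ⟨r, hr⟩ := hpq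
  have h1 : aeval T q.reverse x = 0 := by
    rw [hr, mul_comm, map_mul, Module.End.mul_apply, LinearMap.mem_ker.1 hx, map_zero]
  rw [Polynomial.reverse, aeval_reflect hTS _ q le_rfl, Module.End.mul_apply] at h1
  have h2 : ∀ n : ℕ, ∀ y, (T ^ n) y = 0 → y = 0 := by
    intro n
    induction n with
    | zero => intro y hy; simpa using hy
    | succ n ih =>
      intro y hy
      rw [pow_succ, Module.End.mul_apply] at hy
      have h3 := congrArg S (ih _ hy)
      rwa [map_zero, ← Module.End.mul_apply, hST] at h3
  exact h2 _ _ h1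

theorem dvd_of_irreducible_of_ker {p r : F[X]} (hp : Irreducible p) {x : V} (hx : x ≠ 0)
    (hpx : aeval T p x = 0) (hrx : aeval T r x = 0) : p ∣ r := by
  by_contra hcon
  obtain ⟨a, b, hab⟩ := hp.coprime_iff_not_dvd.2 hcon
  apply hx
  have := congrArg (fun f => aeval T f x) hab
  simpa [hpx, hrx] using this.symm

theorem dvd_reverse_of_ker (hTS : T * S = 1) {p q : F[X]} (hp : Irreducible p) {x : V}
    (hx : x ≠ 0) (hpx : aeval T p x = 0) (hqx : aeval S q x = 0) : p ∣ q.reverse := by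
  refine dvd_of_irreducible_of_ker hp hx hpx ?_
  rw [Polynomial.reverse, aeval_reflect hTS _ q le_rfl, Module.End.mul_apply, hqx, map_zero]

/-- If `f` is injective on a stable subspace `W`, then `W` is orthogonal to the kernel of the
adjoint of `f`. -/
theorem bilin_eq_zero_of_adjoint [FiniteDimensional F V] {B : LinearMap.BilinForm F V}
    {f f' : Module.End F V} (adj : ∀ x y, B (f x) y = B x (f' y)) {W : Submodule F V}
    (hW : ∀ x ∈ W, f x ∈ W) (hd : ∀ x ∈ W, f x = 0 → x = 0) {x y : V} (hx : x ∈ W)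
    (hy : f' y = 0) : B x y = 0 := by
  have hinj : Function.Injective (f.restrict hW) := by
    refine (injective_iff_map_eq_zero _).2 fun a ha => Subtype.ext (hd a a.2 ?_)
    exact congrArg Subtype.val ha
  obtain ⟨z, hz⟩ := (LinearMap.injective_iff_surjective.1 hinj) ⟨x, hx⟩
  have : f z = x := congrArg Subtype.val hz
  rw [← this, adj, hy, map_zero]

/-- Squarefreeness makes an irreducible factor coprime to its cofactor, so the kernel splits and
induction on the degree applies. -/
theorem ker_aeval_le_of_squarefree (U : Submodule F V) (f : F[X]) (hf : Squarefree f)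
    (hU : ∀ p : F[X], p.Monic → Irreducible p → p ∣ f → LinearMap.ker (aeval T p) ≤ U) :
    LinearMap.ker (aeval T f) ≤ U := by
  induction hn : f.natDegree using Nat.strong_induction_on generalizing f with
  | _ n ih =>
  by_cases hu : IsUnit f
  · intro x hx
    have h1 : IsUnit (aeval T f) := hu.map _
    have h2 := ((Module.End.isUnit_iff _).1 h1).1
    have : x = 0 := h2 (by rw [LinearMap.mem_ker.1 hx, map_zero])
    rw [this]; exact U.zero_mem
  · obtain ⟨p, hpm, hp, q, rfl⟩ := exists_monic_irreducible_factor f hu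
    have hcop : IsCoprime p q := by
      refine hp.coprime_iff_not_dvd.2 fun hd => hp.not_isUnit (hf p (mul_dvd_mul_left p hd))
    rw [← sup_ker_aeval_eq_ker_aeval_mul_of_coprime T hcop]
    refine sup_le (hU p hpm hp (dvd_mul_right _ _)) ?_
    have hq0 : q ≠ 0 := by
      rintro rfl
      exact hf.ne_zero (mul_zero p)
    refine ih q.natDegree ?_ q (hf.of_mul_right)
      (fun r h1 h2 h3 => hU r h1 h2 (h3.mul_left p)) rfl
    rw [← hn, natDegree_mul hp.ne_zero hq0]
    have := hp.natDegree_pos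
    omega

end Kernels

/-! ### The orthogonal decomposition attached to an isometry. -/

section Blocks

variable {F : Type*} [Field F] {V : Type*} [AddCommGroup V] [Module F V]
variable {Q : QuadraticForm F V} (h : Q.IsometryEquiv Q)

theorem toEnd_mul_symm : toEnd h * toEnd h.symm = 1 :=
  LinearMap.ext fun x => h.apply_symm_apply x

theorem symm_mul_toEnd : toEnd h.symm * toEnd h = 1 :=
  LinearMap.ext fun x => h.symm_apply_apply x

theorem polar_toEnd (x y : V) :
    Q.polarBilin (toEnd h x) (toEnd h y) = Q.polarBilin x y := by
  have hm : ∀ z, Q (toEnd h z) = Q z := fun z => h.map_app z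
  simp only [QuadraticMap.polarBilin_apply_apply, QuadraticMap.polar, ← map_add, hm]

theorem polar_adjoint (x y : V) :
    Q.polarBilin (toEnd h x) y = Q.polarBilin x (toEnd h.symm y) := by
  rw [← polar_toEnd h x, ← Module.End.mul_apply, toEnd_mul_symm]; rfl

theorem polar_adjoint_symm (x y : V) :
    Q.polarBilin (toEnd h.symm x) y = Q.polarBilin x (toEnd h y) := by
  rw [← polar_toEnd h _ y, ← Module.End.mul_apply, toEnd_mul_symm]; rfl

theorem polar_isSymm (Q : QuadraticForm F V) : LinearMap.BilinForm.IsSymm Q.polarBilin :=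
  ⟨fun x y => QuadraticMap.polar_comm Q x y⟩

theorem block_symm (p : F[X]) : block h.symm p = block h p := sup_comm _ _

-- A common nonzero vector forces `p` to divide the reversal of `q` and conversely; then `ker p(h) =
-- ker q(h⁻¹)` and `ker p(h⁻¹) = ker q(h)`. This is what makes distinct blocks separate.
variable {h} in
theorem block_eq_of_ker {p q : F[X]} (hp : Irreducible p) (hq : Irreducible q) {x : V} (hx : x ≠ 0)
    (hpx : aeval (toEnd h) p x = 0) (hqx : aeval (toEnd h.symm) q x = 0) :
    block h p = block h q := by
  have t := toEnd_mul_symm h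
  have s := symm_mul_toEnd h
  have d1 := dvd_reverse_of_ker t hp hx hpx hqx
  have d2 := dvd_reverse_of_ker s hq hx hqx hpx
  have e1 := ker_aeval_le_of_dvd_reverse t s d1
  have e2 := ker_aeval_le_of_dvd_reverse s t d1
  have e3 := ker_aeval_le_of_dvd_reverse t s d2
  have e4 := ker_aeval_le_of_dvd_reverse s t d2
  exact le_antisymm (sup_le (e1.trans le_sup_right) (e2.trans le_sup_left))
    (sup_le (e3.trans le_sup_right) (e4.trans le_sup_left))

variable [FiniteDimensional F V]

/-- As the blocks differ, `q(h)` and `q(h⁻¹)` are both injective, hence surjective, on `ker p(h)`.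
Each is the adjoint of the other, so `ker p(h)` is orthogonal to both of their kernels. -/
theorem polar_ker_block {p q : F[X]} (hpm : p.Monic) (hqm : q.Monic) (hp : Irreducible p)
    (hq : Irreducible q) (hne : block h p ≠ block h q) {x y : V}
    (hx : x ∈ LinearMap.ker (aeval (toEnd h) p)) (hy : y ∈ block h q) :
    Q.polarBilin x y = 0 := by
  have hst : ∀ z ∈ LinearMap.ker (aeval (toEnd h) p), toEnd h z ∈
      LinearMap.ker (aeval (toEnd h) p) := fun z hz => by
    rw [LinearMap.mem_ker, ← aeval_intertwine (f := toEnd h) (fun _ => rfl),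
      LinearMap.mem_ker.1 hz, map_zero]
  have hst' : ∀ z ∈ LinearMap.ker (aeval (toEnd h) p), toEnd h.symm z ∈
      LinearMap.ker (aeval (toEnd h) p) := fun z hz => inverse_mem (symm_mul_toEnd h) hst hz
  obtain ⟨a, ha, b, hb, rfl⟩ := Submodule.mem_sup.1 hy
  rw [map_add]
  have h1 : Q.polarBilin x a = 0 := by
    refine bilin_eq_zero_of_adjoint (bilin_aeval (polar_adjoint_symm h) q)
      (fun z hz => aeval_mem hst' q hz) (fun z hz hz' => ?_) hx ha
    by_contra hz0
    exact hne (block_eq_of_ker hp hq hz0 hz hz')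
  have h2 : Q.polarBilin x b = 0 := by
    refine bilin_eq_zero_of_adjoint (bilin_aeval (polar_adjoint h) q)
      (fun z hz => aeval_mem hst q hz) (fun z hz hz' => ?_) hx hb
    by_contra hz0
    have hd := dvd_of_irreducible_of_ker hp hz0 hz hz'
    exact hne (congrArg _ (eq_of_monic_of_associated hpm hqm (hp.associated_of_dvd hq hd)))
  rw [h1, h2, add_zero]

theorem polar_block {p q : F[X]} (hpm : p.Monic) (hqm : q.Monic) (hp : Irreducible p)
    (hq : Irreducible q) (hne : block h p ≠ block h q) {x y : V}
    (hx : x ∈ block h p) (hy : y ∈ block h q) : Q.polarBilin x y = 0 := by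
  obtain ⟨a, ha, b, hb, rfl⟩ := Submodule.mem_sup.1 hx
  rw [map_add, LinearMap.add_apply, polar_ker_block h hpm hqm hp hq hne ha hy, zero_add]
  refine polar_ker_block h.symm hpm hqm hp hq ?_ hb ?_ <;> simpa only [block_symm]

-- On an eigenvector `q(h)` is the scalar `q(c)`, nonzero unless `q = X - c`, while its adjoint
-- `q(h⁻¹)` kills `y`.
omit [FiniteDimensional F V] in
theorem polar_eigenspace_ker {q : F[X]} (hqm : q.Monic) (hq : Irreducible q) {c : F}
    (hqc : q ≠ X - C c) {x y : V} (hx : toEnd h x = c • x)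
    (hy : aeval (toEnd h.symm) q y = 0) : Q.polarBilin x y = 0 := by
  by_cases hx0 : x = 0
  · simp [hx0]
  have h1 : aeval (toEnd h) q x = q.eval c • x :=
    Module.End.aeval_apply_of_hasEigenvector ⟨Module.End.mem_eigenspace_iff.2 hx, hx0⟩
  have h2 := bilin_aeval (polar_adjoint h) q x y
  rw [h1, hy, map_zero, map_smul, LinearMap.smul_apply, smul_eq_mul] at h2
  refine (mul_eq_zero.1 h2).resolve_left fun h3 => hqc ?_
  have hd : X - C c ∣ q := dvd_iff_isRoot.2 h3
  exact (eq_of_monic_of_associated (monic_X_sub_C c) hqm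
    ((irreducible_X_sub_C c).associated_of_dvd hq hd)).symm

omit [FiniteDimensional F V] in
theorem polar_eigenspace_block {q : F[X]} (hqm : q.Monic) (hq : Irreducible q) {c : F}
    (hc : c * c = 1) (hqc : q ≠ X - C c) {x y : V} (hx : toEnd h x = c • x)
    (hy : y ∈ block h q) : Q.polarBilin x y = 0 := by
  obtain ⟨a, ha, b, hb, rfl⟩ := Submodule.mem_sup.1 hy
  have hx' : toEnd h.symm x = c • x := by
    have h1 := congrArg (toEnd h.symm) hx
    rw [← Module.End.mul_apply, symm_mul_toEnd, map_smul] at h1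
    have h2 : x = c • toEnd h.symm x := h1
    conv_rhs => rw [h2, smul_smul, hc, one_smul]
  rw [map_add, polar_eigenspace_ker h hqm hq hqc hx hb,
    polar_eigenspace_ker h.symm hqm hq hqc hx' ha, add_zero]

omit [FiniteDimensional F V] in
theorem mem_plusSpace {x : V} : x ∈ plusSpace h ↔ toEnd h x = x := by
  rw [plusSpace, LinearMap.mem_ker, LinearMap.sub_apply, sub_eq_zero]; rfl

omit [FiniteDimensional F V] in
theorem mem_minusSpace {x : V} : x ∈ minusSpace h ↔ toEnd h x = -x := by
  rw [minusSpace, LinearMap.mem_ker, LinearMap.add_apply, add_eq_zero_iff_eq_neg]; rfl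

theorem polar_allBlocks (h2 : (2 : F) ≠ 0) {i j : properBlocks h ⊕ Bool} (hij : i ≠ j) {x y : V}
    (hx : x ∈ allBlocks h i) (hy : y ∈ allBlocks h j) : QuadraticMap.polar Q x y = 0 := by
  have e1 : (X - 1 : F[X]) = X - C 1 := by simp
  have e2 : (X + 1 : F[X]) = X - C (-1) := by simp
  have hp : ∀ x ∈ plusSpace h, ∀ W ∈ properBlocks h, ∀ y ∈ W, QuadraticMap.polar Q x y = 0 := by
    rintro x hx _ ⟨p, hpm, hp, -, hp1, -, rfl⟩ y hy
    exact polar_eigenspace_block h hpm hp (one_mul 1) (e1 ▸ hp1)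
      (by rw [one_smul]; exact (mem_plusSpace h).1 hx) hy
  have hm : ∀ x ∈ minusSpace h, ∀ W ∈ properBlocks h, ∀ y ∈ W,
      QuadraticMap.polar Q x y = 0 := by
    rintro x hx _ ⟨p, hpm, hp, -, -, hp1, rfl⟩ y hy
    exact polar_eigenspace_block h hpm hp (by norm_num) (e2 ▸ hp1)
      (by rw [neg_one_smul]; exact (mem_minusSpace h).1 hx) hy
  have hpm : ∀ x ∈ plusSpace h, ∀ y ∈ minusSpace h, QuadraticMap.polar Q x y = 0 := by
    intro x hx y hy
    have h1 := polar_toEnd h x y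
    rw [(mem_plusSpace h).1 hx, (mem_minusSpace h).1 hy, map_neg] at h1
    have : 2 * Q.polarBilin x y = 0 := by linear_combination -h1
    exact (mul_eq_zero.1 this).resolve_left h2
  rcases i with ⟨W, hW⟩ | (_ | _) <;> rcases j with ⟨W', hW'⟩ | (_ | _)
  · obtain ⟨p, hpm, hp, -, -, -, rfl⟩ := id hW
    obtain ⟨q, hqm, hq, -, -, -, rfl⟩ := id hW'
    exact polar_block h hpm hqm hp hq (fun he => hij (by simp [he])) hx hy
  · rw [QuadraticMap.polar_comm]; exact hm y hy W hW x hx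
  · rw [QuadraticMap.polar_comm]; exact hp y hy W hW x hx
  · exact hm x hx W' hW' y hy
  · exact absurd rfl hij
  · rw [QuadraticMap.polar_comm]; exact hpm y hy x hx
  · exact hp x hx W' hW' y hy
  · exact hpm x hx y hy
  · exact absurd rfl hij

theorem iSup_allBlocks (ss : (toEnd h).IsSemisimple) : iSup (allBlocks h) = ⊤ := by
  rw [eq_top_iff]
  have h1 : LinearMap.ker (aeval (toEnd h) (minpoly F (toEnd h))) = ⊤ := by
    rw [minpoly.aeval, LinearMap.ker_zero]
  rw [← h1]
  refine ker_aeval_le_of_squarefree _ _ ss.minpoly_squarefree fun p hpm hp hpd => ?_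
  by_cases hp1 : p = X - 1
  · refine le_trans ?_ (le_iSup (allBlocks h) (Sum.inr true))
    rw [hp1]; simp [allBlocks, plusSpace]
  by_cases hp2 : p = X + 1
  · refine le_trans ?_ (le_iSup (allBlocks h) (Sum.inr false))
    rw [hp2]; simp [allBlocks, minusSpace]
  · exact le_trans le_sup_left (le_iSup (allBlocks h)
      (Sum.inl ⟨block h p, p, hpm, hp, hpd, hp1, hp2, rfl⟩))

omit [FiniteDimensional F V] in
theorem eq_zero_of_polar_iSup {κ : Type*} {W : κ → Submodule F V}
    (hB : Q.polarBilin.Nondegenerate) (ht : iSup W = ⊤) {x : V}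
    (hx : ∀ i, ∀ y ∈ W i, QuadraticMap.polar Q x y = 0) : x = 0 := by
  refine hB.1 x fun y => ?_
  have hle : iSup W ≤ LinearMap.ker (Q.polarBilin x) := iSup_le hx
  exact hle (ht ▸ Submodule.mem_top)

/-- Independence comes from orthogonality: a vector lying in one block and in the span of the others
is orthogonal to every block, hence to `V`. -/
theorem isOrthogonalDirectSum_allBlocks (hB : Q.polarBilin.Nondegenerate) (h2 : (2 : F) ≠ 0)
    (ss : (toEnd h).IsSemisimple) : IsOrthogonalDirectSum Q (allBlocks h) := by
  refine ⟨fun i => Submodule.disjoint_def.2 fun x hx hx' => ?_, iSup_allBlocks h ss,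
    fun i j hij x hx y hy => polar_allBlocks h h2 hij hx hy⟩
  refine eq_zero_of_polar_iSup hB (iSup_allBlocks h ss) fun j y hy => ?_
  by_cases hij : j = i
  · subst hij
    have hle : (⨆ k, ⨆ (_ : k ≠ j), allBlocks h k) ≤ LinearMap.ker (Q.polarBilin y) :=
      iSup₂_le fun k hk z hz => polar_allBlocks h h2 hk.symm hy hz
    rw [QuadraticMap.polar_comm]
    exact hle hx'
  · exact polar_allBlocks h h2 (Ne.symm hij) hx hy

-- If `Q` vanished on the block, so would its polar form; being orthogonal to the other blocks as
-- well, the block would lie in the radical.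
omit [FiniteDimensional F V] in
theorem IsOrthogonalDirectSum.exists_anisotropic {κ : Type*} {W : κ → Submodule F V}
    (hW : IsOrthogonalDirectSum Q W) (hB : Q.polarBilin.Nondegenerate) {i : κ} (hi : W i ≠ ⊥) :
    ∃ v ∈ W i, Q v ≠ 0 := by
  by_contra! hcon
  refine hi (eq_bot_iff.2 fun x hx => eq_zero_of_polar_iSup hB hW.2.1 fun j y hy => ?_)
  by_cases hij : i = j
  · subst hij
    rw [QuadraticMap.polar, hcon x hx, hcon y hy, hcon _ ((W i).add_mem hx hy)]; simp
  · exact hW.2.2 i j hij x hx y hy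

end Blocks

end GeneralPin

end

noncomputable section

namespace GeneralPin

/-! ### The kernel of `P`: twisted central elements are scalars. -/

section Contraction

variable {F : Type*} [Field F] {V : Type*} [AddCommGroup V] [Module F V]

/-- The twisted commutator with a vector is a contraction. -/
theorem twisted_commutator (Q : QuadraticForm F V) (v : V) (x : CliffordAlgebra Q) :
    ι Q v * x - involute x * ι Q v = contractLeft (Q.polarBilin v) x := by
  induction x using CliffordAlgebra.left_induction with
  | algebraMap r => rw [AlgHom.commutes, contractLeft_algebraMap, Algebra.commutes, sub_self]
  | add x y hx hy => rw [map_add, map_add, ← hx, ← hy]; noncomm_ring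
  | ι_mul x m hx =>
    rw [contractLeft_ι_mul, ← hx, map_mul, involute_ι, QuadraticMap.polarBilin_apply_apply,
      Algebra.smul_def, ← ι_mul_ι_add_swap]
    noncomm_ring

/-- The Euler operator `∑ eᵢ ∧ (eᵢ* ⌋ x)` of the exterior algebra. -/
def eulerOp {κ : Type*} [Fintype κ] (b : Module.Basis κ F V) :
    ExteriorAlgebra F V →ₗ[F] ExteriorAlgebra F V :=
  ∑ i, (LinearMap.mulLeft F (ExteriorAlgebra.ι F (b i))) ∘ₗ
    (contractLeft (Q := (0 : QuadraticForm F V)) (b.coord i))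

theorem eulerOp_ι_mul {κ : Type*} [Fintype κ] (b : Module.Basis κ F V) (v : V)
    (x : ExteriorAlgebra F V) :
    eulerOp b (ExteriorAlgebra.ι F v * x) =
      ExteriorAlgebra.ι F v * x + ExteriorAlgebra.ι F v * eulerOp b x := by
  have h1 : ∀ i, contractLeft (Q := (0 : QuadraticForm F V)) (b.coord i)
      (ExteriorAlgebra.ι F v * x) = b.coord i v • x -
        ExteriorAlgebra.ι F v * contractLeft (Q := (0 : QuadraticForm F V)) (b.coord i) x :=
    fun i => contractLeft_ι_mul _ v x
  have h2 : ExteriorAlgebra.ι F v * x = ∑ i, ExteriorAlgebra.ι F (b i) * (b.coord i v • x) := by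
    conv_lhs => rw [← b.sum_repr v, map_sum, Finset.sum_mul]
    exact Finset.sum_congr rfl fun i _ => by
      rw [map_smul, smul_mul_assoc, mul_smul_comm, Module.Basis.coord_apply]
  have h3 : ∀ i, ExteriorAlgebra.ι F (b i) * ExteriorAlgebra.ι F v =
      -(ExteriorAlgebra.ι F v * ExteriorAlgebra.ι F (b i)) := fun i =>
    eq_neg_of_add_eq_zero_left (ExteriorAlgebra.ι_add_mul_swap _ _)
  simp only [eulerOp, LinearMap.sum_apply, LinearMap.comp_apply, LinearMap.mulLeft_apply, h1]
  conv_rhs => rw [h2, Finset.mul_sum, ← Finset.sum_add_distrib]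
  refine Finset.sum_congr rfl fun i _ => ?_
  rw [mul_sub, ← mul_assoc, h3, neg_mul, sub_neg_eq_add, mul_assoc]

theorem eulerOp_of_mem {κ : Type*} [Fintype κ] (b : Module.Basis κ F V) (n : ℕ)
    (x : ExteriorAlgebra F V) (hx : x ∈ ⋀[F]^n V) : eulerOp b x = (n : F) • x := by
  induction hx using Submodule.pow_induction_on_left' with
  | algebraMap r =>
    have : ∀ i, contractLeft (Q := (0 : QuadraticForm F V)) (b.coord i)
      (algebraMap F (ExteriorAlgebra F V) r) = 0 :=
      fun i => contractLeft_algebraMap (Q := (0 : QuadraticForm F V)) (b.coord i) r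
    simp [eulerOp, this]
  | add x y i hx hy ihx ihy => rw [map_add, ihx, ihy, smul_add]
  | mem_mul m hm i x hx ih =>
    obtain ⟨v, rfl⟩ := hm
    rw [eulerOp_ι_mul, ih, Nat.cast_succ, add_smul, one_smul, mul_smul_comm, add_comm]

/-- The Euler operator multiplies degree `j` by `j`, which is invertible in characteristic zero
unless `j = 0`. -/
theorem mem_range_algebraMap_of_eulerOp [CharZero F] {κ : Type*} [Fintype κ]
    (b : Module.Basis κ F V) {x : ExteriorAlgebra F V} (hx : eulerOp b x = 0) :
    x ∈ Set.range (algebraMap F (ExteriorAlgebra F V)) := by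
  classical
  let 𝒜 : ℕ → Submodule F (ExteriorAlgebra F V) := fun i => ⋀[F]^i V
  have key : ∀ (j : ℕ) (y : ExteriorAlgebra F V),
      (DirectSum.decompose 𝒜 (eulerOp b y) j : ExteriorAlgebra F V) =
        (j : F) • (DirectSum.decompose 𝒜 y j : ExteriorAlgebra F V) := by
    intro j y
    induction y using DirectSum.Decomposition.inductionOn 𝒜 with
    | zero => simp
    | add y z hy hz => simp [hy, hz]
    | @homogeneous i y =>
      rw [eulerOp_of_mem b i y y.2, DirectSum.decompose_smul]
      by_cases hij : i = j
      · subst hij; rfl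
      · have h0 := DirectSum.decompose_of_mem_ne 𝒜 y.2 hij
        change (i : F) • ((DirectSum.decompose 𝒜 (y : ExteriorAlgebra F V) j : 𝒜 j) :
          ExteriorAlgebra F V) = _
        rw [h0, smul_zero, smul_zero]
  have h0 : ∀ j, j ≠ 0 → (DirectSum.decompose 𝒜 x j : ExteriorAlgebra F V) = 0 := by
    intro j hj
    have := key j x
    rw [hx, DirectSum.decompose_zero] at this
    exact (smul_eq_zero.1 this.symm).resolve_left (Nat.cast_ne_zero.2 hj)
  have h1 : x = (DirectSum.decompose 𝒜 x 0 : ExteriorAlgebra F V) := by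
    conv_lhs => rw [← DirectSum.sum_support_decompose 𝒜 x]
    refine Finset.sum_eq_single 0 (fun j _ hj => h0 j hj) fun hj => ?_
    simpa using hj
  have h2 : x ∈ ⋀[F]^0 V := by rw [h1]; exact (DirectSum.decompose 𝒜 x 0).2
  have h3 : x ∈ (1 : Submodule F (ExteriorAlgebra F V)) := by simpa using h2
  exact Submodule.mem_one.1 h3

variable [CharZero F] [FiniteDimensional F V] {Q : QuadraticForm F V}

/-- The linear isomorphism with the exterior algebra commutes with contractions and preserves
scalars, so the Euler operator decides the question there. -/
theorem mem_range_algebraMap_of_contractLeft {x : CliffordAlgebra Q}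
    (hx : ∀ d : Module.Dual F V, contractLeft d x = 0) :
    x ∈ Set.range (algebraMap F (CliffordAlgebra Q)) := by
  have : Invertible (2 : F) := invertibleOfNonzero two_ne_zero
  have h1 : ∀ d : Module.Dual F V,
      contractLeft (Q := (0 : QuadraticForm F V)) d (equivExterior Q x) = 0 := by
    intro d
    have h2 : equivExterior Q (contractLeft d x) =
        contractLeft (Q := (0 : QuadraticForm F V)) d (equivExterior Q x) :=
      changeForm_contractLeft changeForm.associated_neg_proof d x
    rw [← h2, hx, map_zero]
  obtain ⟨r, hr⟩ := mem_range_algebraMap_of_eulerOp (Module.finBasis F V)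
    (x := equivExterior Q x) (by
      simp only [eulerOp, LinearMap.sum_apply, LinearMap.comp_apply]
      exact Finset.sum_eq_zero fun i _ => by rw [h1, map_zero])
  refine ⟨r, (equivExterior Q).injective ?_⟩
  rw [← hr]
  exact changeForm_algebraMap changeForm.associated_neg_proof r

/-- By nondegeneracy every linear form is pairing with some `v`, and contraction by it is the
twisted commutator with `v`. Applied to an element with trivial image under `P`, this determines
lifts up to scalars. -/
theorem mem_range_algebraMap_of_twisted_central (hB : Q.polarBilin.Nondegenerate)
    {x : CliffordAlgebra Q} (hx : ∀ v, involute x * ι Q v = ι Q v * x) :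
    x ∈ Set.range (algebraMap F (CliffordAlgebra Q)) := by
  refine mem_range_algebraMap_of_contractLeft fun d => ?_
  obtain ⟨v, rfl⟩ := (LinearMap.BilinForm.toDual Q.polarBilin hB).surjective d
  change contractLeft (Q.polarBilin v) x = 0
  rw [← twisted_commutator, hx, sub_self]

theorem finiteDimensional_cliffordAlgebra (Q : QuadraticForm F V) :
    FiniteDimensional F (CliffordAlgebra Q) := by
  have : Invertible (2 : F) := invertibleOfNonzero two_ne_zero
  have : Module.Finite F (ExteriorAlgebra F V) :=
    Module.Finite.of_basis (Module.finBasis F V).ExteriorAlgebra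
  exact Module.Finite.equiv (equivExterior Q).symm

end Contraction

/-! ### Semisimplicity passes from `g` to `P(g)`. -/

section Semisimple

variable {F : Type*} [Field F] {A : Type*} [Ring A] [Algebra F A]

theorem aeval_mulLeft (a : A) (p : F[X]) (x : A) :
    aeval (LinearMap.mulLeft F a) p x = aeval a p * x := by
  have h : ∀ n : ℕ, ∀ x, (LinearMap.mulLeft F a ^ n) x = a ^ n * x := fun n x => by simp
  induction p using Polynomial.induction_on' with
  | add p q hp hq => simp [hp, hq, add_mul]
  | monomial n r => simp [aeval_monomial, mul_assoc, Algebra.smul_def]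

theorem aeval_mulRight (a : A) (p : F[X]) (x : A) :
    aeval (LinearMap.mulRight F a) p x = x * aeval a p := by
  induction p using Polynomial.induction_on' with
  | add p q hp hq => simp [hp, hq, mul_add]
  | monomial n r => simp [aeval_monomial, Algebra.left_comm, Algebra.smul_def]

theorem isSemisimple_of_inverse {V : Type*} [AddCommGroup V] [Module F V] [FiniteDimensional F V]
    {T S : Module.End F V} (hTS : T * S = 1) (hST : S * T = 1) (hT : T.IsSemisimple) :
    S.IsSemisimple := by
  refine Module.End.isSemisimple_iff.2 fun p hp => ?_
  obtain ⟨q, hq, hpq⟩ := Module.End.isSemisimple_iff.1 hT p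
    (fun x hx => inverse_mem hTS hp hx)
  exact ⟨q, fun x hx => inverse_mem hST hq hx, hpq⟩

variable {V : Type*} [AddCommGroup V] [Module F V] [FiniteDimensional F V] [CharZero F]
  {Q : QuadraticForm F V}

/-- `P(g)` is the restriction to `V` of left multiplication by `α(g)` times right multiplication by
`g⁻¹`. These commute, and each is semisimple because a squarefree polynomial killing `g` also kills
`α(g)` and right multiplication by `g`. -/
theorem isSemisimple_proj (g : GPin Q) (hg : IsSemisimpleElt g) :
    (toEnd (proj g)).IsSemisimple := by
  have := finiteDimensional_cliffordAlgebra Q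
  set a : CliffordAlgebra Q := ((g : (CliffordAlgebra Q)ˣ) : CliffordAlgebra Q) with ha
  set a' : CliffordAlgebra Q := (((g : (CliffordAlgebra Q)ˣ)⁻¹ : (CliffordAlgebra Q)ˣ) :
    CliffordAlgebra Q) with ha'
  have haa' : a * a' = 1 := Units.mul_inv _
  have ha'a : a' * a = 1 := Units.inv_mul _
  have hsq : Squarefree (minpoly F (LinearMap.mulLeft F a)) :=
    Module.End.IsSemisimple.minpoly_squarefree hg
  set f := minpoly F (LinearMap.mulLeft F a) with hf
  have hfa : aeval a f = 0 := by
    have := LinearMap.congr_fun (minpoly.aeval F (LinearMap.mulLeft F a)) 1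
    rwa [aeval_mulLeft, mul_one] at this
  have s1 : Module.End.IsSemisimple (LinearMap.mulLeft F (involute a)) := by
    refine Module.End.isSemisimple_of_squarefree_aeval_eq_zero hsq (LinearMap.ext fun x => ?_)
    rw [aeval_mulLeft, aeval_algHom_apply, hfa, map_zero, zero_mul]; rfl
  have s2 : Module.End.IsSemisimple (LinearMap.mulRight F a) := by
    refine Module.End.isSemisimple_of_squarefree_aeval_eq_zero hsq (LinearMap.ext fun x => ?_)
    rw [aeval_mulRight, hfa, mul_zero]; rfl
  have s3 : Module.End.IsSemisimple (LinearMap.mulRight F a') := by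
    refine isSemisimple_of_inverse (LinearMap.ext fun x => ?_) (LinearMap.ext fun x => ?_) s2
    · simp [mul_assoc, ha'a]
    · simp [mul_assoc, haa']
  have s4 := Module.End.IsSemisimple.mul_of_commute
    (LinearMap.commute_mulLeft_right (R := F) (involute a) a') s1 s3
  refine Module.End.isSemisimple_of_squarefree_aeval_eq_zero s4.minpoly_squarefree
    (LinearMap.ext fun v => iota_injective (Q := Q) ?_)
  rw [aeval_intertwine (f := ι Q) (S := LinearMap.mulLeft F (involute a) * LinearMap.mulRight F a')
    (fun v => ?_), minpoly.aeval]
  · simp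
  · change ι Q (projFun g v) = _
    rw [iota_projFun]
    simp [ha, ha', mul_assoc]

end Semisimple

end GeneralPin

end

noncomputable section

namespace GeneralPin

/-! ### Anisotropic vectors, reflections and lifts of involutions. -/

section Lift

variable {F : Type*} [Field F] {V : Type*} [AddCommGroup V] [Module F V]
variable {Q : QuadraticForm F V}

/-- The element of the Clifford algebra underlying an element of `GPin`. -/
abbrev cl (g : GPin Q) : CliffordAlgebra Q := ((g : (CliffordAlgebra Q)ˣ) : CliffordAlgebra Q)

theorem cl_mul (g g' : GPin Q) : cl (g * g') = cl g * cl g' := rfl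

theorem cl_mul_inv (g : GPin Q) : cl g * cl g⁻¹ = 1 := Units.mul_inv (g : (CliffordAlgebra Q)ˣ)

theorem cl_inv_mul (g : GPin Q) : cl g⁻¹ * cl g = 1 := Units.inv_mul (g : (CliffordAlgebra Q)ˣ)

theorem cl_injective : Function.Injective (cl (Q := Q)) :=
  fun _ _ hab => Subtype.ext (Units.ext hab)

/-- The orthogonal reflection in an anisotropic vector. -/
def refl (Q : QuadraticForm F V) (v : V) : Module.End F V :=
  1 - ((Q v)⁻¹ • Q.polarBilin v).smulRight v

theorem refl_apply (v w : V) :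
    refl Q v w = w - ((Q v)⁻¹ * QuadraticMap.polar Q v w) • v := rfl

theorem refl_refl {v : V} (hv : Q v ≠ 0) (w : V) : refl Q v (refl Q v w) = w := by
  have h1 : Q.polarBilin v (refl Q v w) = -Q.polarBilin v w := by
    rw [refl_apply, map_sub, map_smul, QuadraticMap.polarBilin_apply_apply,
      QuadraticMap.polarBilin_apply_apply, QuadraticMap.polar_self, smul_eq_mul, nsmul_eq_mul]
    field_simp
    push_cast
    ring
  rw [QuadraticMap.polarBilin_apply_apply, QuadraticMap.polarBilin_apply_apply] at h1
  rw [refl_apply v (refl Q v w), h1, refl_apply, mul_neg, neg_smul]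
  abel

/-- An anisotropic vector as a unit of the Clifford algebra. -/
def vecUnit (v : V) (hv : Q v ≠ 0) : (CliffordAlgebra Q)ˣ where
  val := ι Q v
  inv := (Q v)⁻¹ • ι Q v
  val_inv := by
    rw [mul_smul_comm, ι_sq_scalar, Algebra.smul_def, ← map_mul, inv_mul_cancel₀ hv, map_one]
  inv_val := by
    rw [smul_mul_assoc, ι_sq_scalar, Algebra.smul_def, ← map_mul, inv_mul_cancel₀ hv, map_one]

theorem vecUnit_conj (v : V) (hv : Q v ≠ 0) (w : V) :
    involute (vecUnit v hv : CliffordAlgebra Q) * ι Q w *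
      (↑(vecUnit v hv)⁻¹ : CliffordAlgebra Q) = ι Q (refl Q v w) := by
  change involute (ι Q v) * ι Q w * ((Q v)⁻¹ • ι Q v) = _
  rw [involute_ι, neg_mul, neg_mul, mul_smul_comm, ι_mul_ι_mul_ι, ← map_smul, ← map_neg,
    refl_apply, smul_sub, smul_smul, smul_smul, inv_mul_cancel₀ hv, one_smul, neg_sub]

/-- An anisotropic vector as an element of `GPin`. -/
def vec (v : V) (hv : Q v ≠ 0) : GPin Q where
  val := vecUnit v hv
  property := by
    change (fun x : CliffordAlgebra Q => involute (vecUnit v hv : CliffordAlgebra Q) * x *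
      (↑(vecUnit v hv)⁻¹ : CliffordAlgebra Q)) '' Set.range (ι Q) = Set.range (ι Q)
    refine Set.Subset.antisymm ?_ ?_
    · rintro _ ⟨_, ⟨w, rfl⟩, rfl⟩
      exact ⟨refl Q v w, (vecUnit_conj v hv w).symm⟩
    · rintro _ ⟨w, rfl⟩
      refine ⟨_, ⟨refl Q v w, rfl⟩, ?_⟩
      exact (vecUnit_conj v hv _).trans (by rw [refl_refl hv])

theorem cl_vec (v : V) (hv : Q v ≠ 0) : cl (vec v hv) = ι Q v := rfl

variable [NeZero (2 : F)]

theorem ι_toEnd_proj (g : GPin Q) (v : V) :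
    ι Q (toEnd (proj g) v) = involute (cl g) * ι Q v * cl g⁻¹ := iota_projFun g v

theorem ι_toEnd_proj_mul (g : GPin Q) (v : V) :
    ι Q (toEnd (proj g) v) * cl g = involute (cl g) * ι Q v := by
  rw [ι_toEnd_proj, mul_assoc, cl_inv_mul, mul_one]

theorem toEnd_proj_mul (g g' : GPin Q) :
    toEnd (proj (g * g')) = toEnd (proj g) * toEnd (proj g') :=
  LinearMap.ext fun v => (projFun_projFun g g' v).symm

theorem toEnd_proj_one : toEnd (proj (1 : GPin Q)) = 1 := LinearMap.ext fun v => projFun_one v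

theorem toEnd_proj_inv (g : GPin Q) : toEnd (proj g) * toEnd (proj g⁻¹) = 1 := by
  rw [← toEnd_proj_mul, mul_inv_cancel, toEnd_proj_one]

theorem toEnd_proj_vec (v : V) (hv : Q v ≠ 0) : toEnd (proj (vec v hv)) = refl Q v :=
  LinearMap.ext fun w => iota_injective (Q := Q)
    ((ι_toEnd_proj _ w).trans (vecUnit_conj v hv w))

/-- Conjugation by a vector fixed by `P(g)` is the grading automorphism on `g`. -/
theorem vec_conj_of_plus (g : GPin Q) {v : V} (hv : Q v ≠ 0) (hg : toEnd (proj g) v = v) :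
    cl (vec v hv * g * (vec v hv)⁻¹) = involute (cl g) := by
  have := ι_toEnd_proj_mul g v
  rw [hg] at this
  rw [cl_mul, cl_mul, cl_vec, this, mul_assoc, ← cl_vec v hv, cl_mul_inv, mul_one]

theorem vec_conj_of_minus (g : GPin Q) {v : V} (hv : Q v ≠ 0) (hg : toEnd (proj g) v = -v) :
    cl (vec v hv * g * (vec v hv)⁻¹) = -involute (cl g) := by
  have := ι_toEnd_proj_mul g v
  rw [hg, map_neg, neg_mul] at this
  rw [cl_mul, cl_mul, cl_vec, ← neg_neg (ι Q v * cl g), this, neg_mul, mul_assoc,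
    ← cl_vec v hv, cl_mul_inv, mul_one]

theorem mem_even_of_involute_eq {x : CliffordAlgebra Q} (hx : involute x = x) :
    x ∈ even Q := by
  have h2 : (2 : F) ≠ 0 := NeZero.ne 2
  obtain ⟨a, ha, b, hb, rfl⟩ := Submodule.mem_sup.1
    ((evenOdd_isCompl (Q := Q)).sup_eq_top ▸ Submodule.mem_top : x ∈ evenOdd Q 0 ⊔ evenOdd Q 1)
  rw [map_add, involute_eq_of_mem_even ha, involute_eq_of_mem_odd hb, add_right_inj] at hx
  have : (2 : F) • b = 0 := by rw [two_smul]; nth_rewrite 1 [← hx]; exact neg_add_cancel b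
  rw [(smul_eq_zero.1 this).resolve_left h2, add_zero]
  exact ha

theorem mem_GSpin_iff (g : GPin Q) :
    (g : (CliffordAlgebra Q)ˣ) ∈ GSpin Q ↔ involute (cl g) = cl g := by
  refine ⟨fun hg => involute_eq_of_mem_even hg.1, fun hg => ?_⟩
  refine ⟨mem_even_of_involute_eq hg, mem_even_of_involute_eq ?_, ?_⟩
  · change involute (cl g⁻¹) = cl g⁻¹
    calc involute (cl g⁻¹) = cl g⁻¹ * (cl g * involute (cl g⁻¹)) := by
          rw [← mul_assoc, cl_inv_mul, one_mul]
      _ = cl g⁻¹ := by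
          nth_rewrite 1 [← hg]
          rw [← map_mul, cl_mul_inv, map_one, mul_one]
  · have h3 := g.2
    change (fun x : CliffordAlgebra Q => involute (cl g) * x * cl g⁻¹) '' Set.range (ι Q) =
      Set.range (ι Q) at h3
    rw [hg] at h3
    exact h3

variable [FiniteDimensional F V]

/-- Composing with the reflection in `v` removes exactly the line of `v`: the new `-1`-eigenspace is
the orthogonal complement of `v` in the old one. -/
theorem finrank_ker_refl_mul {β : Module.End F V}
    (hi : ∀ x, β (β x) = x) (ho : ∀ x y, Q.polarBilin (β x) (β y) = Q.polarBilin x y)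
    {v : V} (hv : Q v ≠ 0) (hvβ : β v = -v) :
    Module.finrank F (LinearMap.ker (β + 1)) =
      Module.finrank F (LinearMap.ker (refl Q v * β + 1)) + 1 := by
  have h2 : (2 : F) ≠ 0 := NeZero.ne 2
  have hvv : Q.polarBilin v v = 2 * Q v := by
    rw [QuadraticMap.polarBilin_apply_apply, QuadraticMap.polar_self, nsmul_eq_mul]; norm_num
  have mem : ∀ x, x ∈ LinearMap.ker (refl Q v * β + 1) ↔ β x = -x ∧ Q.polarBilin v x = 0 := by
    intro x
    have hvx : Q.polarBilin v (β x) = -Q.polarBilin v x := by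
      rw [← ho, hi, hvβ, map_neg, LinearMap.neg_apply]
    have e : x ∈ LinearMap.ker (refl Q v * β + 1) ↔
        β x - ((Q v)⁻¹ * Q.polarBilin v (β x)) • v + x = 0 := Iff.rfl
    rw [e, hvx]
    constructor
    · intro hx
      have h3 := congrArg (Q.polarBilin v) hx
      rw [map_add, map_sub, map_smul, hvx, hvv, map_zero, smul_eq_mul] at h3
      have h4 : 2 * Q.polarBilin v x = 0 := by
        field_simp at h3
        linear_combination h3
      have h5 := (mul_eq_zero.1 h4).resolve_left h2
      refine ⟨?_, h5⟩
      rw [h5, neg_zero, mul_zero, zero_smul, sub_zero] at hx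
      exact eq_neg_of_add_eq_zero_left hx
    · rintro ⟨h3, h4⟩
      rw [h3, h4]; simp
  have hmE : ∀ x, x ∈ LinearMap.ker (β + 1) ↔ β x = -x := fun x => by
    rw [LinearMap.mem_ker, LinearMap.add_apply, add_eq_zero_iff_eq_neg]; rfl
  have hv0 : v ≠ 0 := by rintro rfl; exact hv (map_zero Q)
  have hsup : LinearMap.ker (refl Q v * β + 1) ⊔ Submodule.span F {v} = LinearMap.ker (β + 1) := by
    refine le_antisymm (sup_le (fun x hx => (hmE x).2 ((mem x).1 hx).1) ?_) fun x hx => ?_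
    · rw [Submodule.span_singleton_le_iff_mem]; exact (hmE v).2 hvβ
    · set c := (2 * Q v)⁻¹ * Q.polarBilin v x with hc
      have : x = (x - c • v) + c • v := by abel
      rw [this]
      refine Submodule.add_mem_sup ((mem _).2 ⟨?_, ?_⟩)
        (Submodule.smul_mem _ _ (Submodule.mem_span_singleton_self v))
      · rw [map_sub, map_smul, hvβ, (hmE x).1 hx, smul_neg, neg_sub_neg, neg_sub]
      · rw [map_sub, map_smul, hvv, smul_eq_mul, hc]
        field_simp
        ring
  have hinf : LinearMap.ker (refl Q v * β + 1) ⊓ Submodule.span F {v} = ⊥ := by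
    refine eq_bot_iff.2 fun x hx => ?_
    obtain ⟨c, rfl⟩ := Submodule.mem_span_singleton.1 hx.2
    have h3 := ((mem _).1 hx.1).2
    rw [map_smul, hvv, smul_eq_mul, mul_eq_zero, or_iff_left (mul_ne_zero h2 hv)] at h3
    simp [h3]
  have h6 := Submodule.finrank_sup_add_finrank_inf_eq (LinearMap.ker (refl Q v * β + 1))
    (Submodule.span F {v})
  rw [hsup, hinf, finrank_bot, finrank_span_singleton hv0] at h6
  exact h6

/-- An isometric involution lifts to `GPin` as a product of pairwise orthogonal vectors, as many as
the dimension of its `-1`-eigenspace. -/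
theorem exists_lift_involution (hB : Q.polarBilin.Nondegenerate) (s : ℕ) (β : Module.End F V)
    (hi : ∀ x, β (β x) = x) (ho : ∀ x y, Q.polarBilin (β x) (β y) = Q.polarBilin x y)
    (hs : Module.finrank F (LinearMap.ker (β + 1)) = s) :
    ∃ u : GPin Q, toEnd (proj u) = β ∧ reverse (cl u) = (-1 : F) ^ s.choose 2 • cl u ∧
      involute (cl u) = (-1 : F) ^ s • cl u := by
  have h2 : (2 : F) ≠ 0 := NeZero.ne 2
  have hmE : ∀ x, x ∈ LinearMap.ker (β + 1) ↔ β x = -x := fun x => by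
    rw [LinearMap.mem_ker, LinearMap.add_apply, add_eq_zero_iff_eq_neg]; rfl
  induction s generalizing β with
  | zero =>
    refine ⟨1, ?_, ?_, ?_⟩
    · rw [toEnd_proj_one]
      refine LinearMap.ext fun x => ?_
      have h3 : x - β x ∈ LinearMap.ker (β + 1) := by
        rw [hmE, map_sub, hi, neg_sub]
      rw [Submodule.finrank_eq_zero.1 hs, Submodule.mem_bot, sub_eq_zero] at h3
      exact h3
    · change reverse (1 : CliffordAlgebra Q) = _ • 1
      rw [reverse.map_one]; simp
    · change involute (1 : CliffordAlgebra Q) = _ • 1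
      rw [map_one]; simp
  | succ s ih =>
    -- The `-1`-eigenspace is orthogonal to the `+1`-eigenspace, so if it were totally isotropic it
    -- would be in the radical, against its positive dimension.
    obtain ⟨v, hvβ, hv⟩ : ∃ v, β v = -v ∧ Q v ≠ 0 := by
      by_contra! hcon
      have hE : LinearMap.ker (β + 1) = ⊥ := by
        refine eq_bot_iff.2 fun x hx => hB.1 x fun y => ?_
        have hx' := (hmE x).1 hx
        have h3 : Q.polarBilin x (y - β y) = 0 := by
          have h4 : β (y - β y) = -(y - β y) := by rw [map_sub, hi, neg_sub]
          have h5 : β (x + (y - β y)) = -(x + (y - β y)) := by rw [map_add, h4, hx', neg_add]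
          rw [QuadraticMap.polarBilin_apply_apply, QuadraticMap.polar, hcon _ h5, hcon _ h4,
            hcon _ hx']
          simp
        have h4 : Q.polarBilin x (β y) = -Q.polarBilin x y := by
          rw [← ho x y, hx', map_neg, LinearMap.neg_apply, neg_neg]
        rw [map_sub, h4] at h3
        have h5 : 2 * Q.polarBilin x y = 0 := by linear_combination h3
        exact (mul_eq_zero.1 h5).resolve_left h2
      rw [hE, finrank_bot] at hs
      omega
    have hr : ∀ w, refl Q v (β w) = β (refl Q v w) := by
      intro w
      have hvx : QuadraticMap.polar Q v (β w) = -QuadraticMap.polar Q v w := by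
        have := ho v (β w)
        rw [hi, hvβ, map_neg, LinearMap.neg_apply] at this
        exact this.symm
      rw [refl_apply, refl_apply, hvx, map_sub, map_smul, hvβ, mul_neg, neg_smul, smul_neg]
    have hor : ∀ x y, Q.polarBilin (refl Q v x) (refl Q v y) = Q.polarBilin x y := by
      intro x y
      rw [← toEnd_proj_vec v hv, polar_toEnd]
    have hfin := finrank_ker_refl_mul hi ho hv hvβ
    obtain ⟨u, hu, hrev, hinv⟩ := ih (refl Q v * β)
      (fun x => by
        rw [Module.End.mul_apply, Module.End.mul_apply, ← hr, hi, refl_refl hv])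
      (fun x y => by rw [Module.End.mul_apply, Module.End.mul_apply, hor, ho])
      (by omega) (fun x => by
        rw [LinearMap.mem_ker, LinearMap.add_apply, add_eq_zero_iff_eq_neg]; rfl)
    have hrv : refl Q v v = -v := by
      rw [refl_apply, QuadraticMap.polar_self, nsmul_eq_mul]
      field_simp
      rw [Nat.cast_ofNat, two_smul]; abel
    have huv : toEnd (proj u) v = v := by
      rw [hu, Module.End.mul_apply, hvβ, map_neg, hrv, neg_neg]
    -- `P(u)` fixes `v`, so moving `v` past `u` costs `(-1) ^ s`; this is the increment from
    -- `s.choose 2` to `(s + 1).choose 2` in the sign of the reversal.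
    have hcomm : cl u * ι Q v = (-1 : F) ^ s • (ι Q v * cl u) := by
      have h3 := ι_toEnd_proj_mul u v
      rw [huv, hinv, smul_mul_assoc] at h3
      rw [h3, smul_smul, ← mul_pow, neg_one_mul, neg_neg, one_pow, one_smul]
    refine ⟨vec v hv * u, ?_, ?_, ?_⟩
    · rw [toEnd_proj_mul, toEnd_proj_vec, hu]
      exact LinearMap.ext fun x => refl_refl hv _
    · rw [cl_mul, cl_vec, reverse.map_mul, reverse_ι, hrev, smul_mul_assoc, hcomm, smul_smul,
        Nat.choose_succ_succ' s 1, Nat.choose_one_right, ← pow_add, add_comm s]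
    · rw [cl_mul, cl_vec, map_mul, involute_ι, hinv, pow_succ, mul_smul_comm, neg_mul, mul_neg_one,
        neg_smul, smul_neg]

end Lift

end GeneralPin

end

noncomputable section

namespace GeneralPin

/-! ### Determinants on the blocks. -/

section Dets

variable {F : Type*} [Field F] {V : Type*} [AddCommGroup V] [Module F V]

theorem det_of_hyperplane_reflection [FiniteDimensional F V] {R : Module.End F V} {v : V}
    (h2 : (2 : F) ≠ 0) (hv : v ≠ 0) (hRv : R v = -v) (hR : ∀ x, ∃ c : F, R x = x - c • v) :
    LinearMap.det R = -1 := by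
  have hi : ∀ x, R (R x) = x := by
    intro x
    obtain ⟨c, hc⟩ := hR x
    rw [hc, map_sub, hc, map_smul, hRv, smul_neg]; abel
  have hk : LinearMap.ker (R + 1) = Submodule.span F {v} := by
    refine le_antisymm (fun x hx => ?_) ?_
    · obtain ⟨c, hc⟩ := hR x
      have h3 : R x + x = 0 := hx
      rw [hc] at h3
      have h4 : (2 : F) • x = c • v := by
        rw [two_smul, ← sub_eq_zero, ← h3]; abel
      refine Submodule.mem_span_singleton.2 ⟨2⁻¹ * c, ?_⟩
      rw [mul_smul, ← h4, smul_smul, inv_mul_cancel₀ h2, one_smul]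
    · rw [Submodule.span_singleton_le_iff_mem]
      change R v + v = 0
      rw [hRv, neg_add_cancel]
  rw [det_of_involution hi h2, hk, finrank_span_singleton hv, pow_one]

variable {Q : QuadraticForm F V}

theorem hasDetOn_one_of_fixed {β : Q.IsometryEquiv Q} {W : Submodule F V}
    (h : ∀ x ∈ W, toEnd β x = x) : HasDetOn β W 1 := by
  refine ⟨fun x hx => by rw [h x hx]; exact hx, ?_⟩
  rw [show (toEnd β).restrict _ = (LinearMap.id : Module.End F W) from
    LinearMap.ext fun x => Subtype.ext (h x x.2), LinearMap.det_id]

theorem HasDetOn.mul [NeZero (2 : F)] {a b : GPin Q} {W : Submodule F V} {d e : F}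
    (ha : HasDetOn (proj a) W d) (hb : HasDetOn (proj b) W e) :
    HasDetOn (proj (a * b)) W (d * e) := by
  obtain ⟨ha, rfl⟩ := ha
  obtain ⟨hb, rfl⟩ := hb
  have hm : ∀ x, toEnd (proj (a * b)) x = toEnd (proj a) (toEnd (proj b) x) := fun x => by
    rw [toEnd_proj_mul, Module.End.mul_apply]
  refine ⟨fun x hx => by rw [hm]; exact ha _ (hb _ hx), ?_⟩
  rw [← map_mul]
  congr 1
  exact LinearMap.ext fun x => Subtype.ext (hm x)

theorem hasDetOn_vec_of_mem [NeZero (2 : F)] [FiniteDimensional F V] {W : Submodule F V} {v : V}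
    (hv : Q v ≠ 0) (hvW : v ∈ W) : HasDetOn (proj (vec v hv)) W (-1) := by
  have hw : ∀ x, toEnd (proj (vec v hv)) x = x - ((Q v)⁻¹ * QuadraticMap.polar Q v x) • v :=
    fun x => by rw [toEnd_proj_vec, refl_apply]
  have hmem : ∀ x ∈ W, toEnd (proj (vec v hv)) x ∈ W := fun x hx => by
    rw [hw]; exact W.sub_mem hx (W.smul_mem _ hvW)
  refine ⟨hmem, det_of_hyperplane_reflection (v := ⟨v, hvW⟩) (NeZero.ne 2) ?_ ?_ fun x => ?_⟩
  · intro h0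
    have : v = 0 := congrArg Subtype.val h0
    exact hv (by rw [this, map_zero])
  · refine Subtype.ext ?_
    change toEnd (proj (vec v hv)) v = -v
    rw [hw, QuadraticMap.polar_self, nsmul_eq_mul]
    field_simp
    rw [Nat.cast_ofNat, two_smul]; abel
  · exact ⟨(Q v)⁻¹ * QuadraticMap.polar Q v x, Subtype.ext (hw x)⟩

theorem hasDetOn_vec_of_orthogonal [NeZero (2 : F)] {W : Submodule F V} {v : V}
    (hv : Q v ≠ 0) (hvW : ∀ x ∈ W, QuadraticMap.polar Q v x = 0) :
    HasDetOn (proj (vec v hv)) W 1 := by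
  refine hasDetOn_one_of_fixed fun x hx => ?_
  rw [toEnd_proj_vec, refl_apply, hvW x hx, mul_zero, zero_smul, sub_zero]

theorem HasDetOn.det_eq {β : Q.IsometryEquiv Q} {d : F} (h : HasDetOn β ⊤ d) :
    LinearMap.det (toEnd β) = d := by
  obtain ⟨hm, rfl⟩ := h
  rw [← LinearMap.det_conj ((toEnd β).restrict hm) Submodule.topEquiv]
  congr 1

theorem ker_sub_symm_eq {h : Q.IsometryEquiv Q} (h2 : (2 : F) ≠ 0) :
    LinearMap.ker (toEnd h - toEnd h.symm) = plusSpace h ⊔ minusSpace h := by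
  have hr : ∀ y, toEnd h (toEnd h.symm y) = y := h.apply_symm_apply
  have hl : ∀ y, toEnd h.symm (toEnd h y) = y := h.symm_apply_apply
  refine le_antisymm (fun x hx => ?_) (sup_le (fun x hx => ?_) fun x hx => ?_)
  · rw [LinearMap.mem_ker, LinearMap.sub_apply, sub_eq_zero] at hx
    have hhx : toEnd h (toEnd h x) = x := by rw [hx, hr]
    have : x = (2 : F)⁻¹ • (x + toEnd h x) + (2 : F)⁻¹ • (x - toEnd h x) := by
      rw [← smul_add, add_add_sub_cancel, ← two_smul F, smul_smul, inv_mul_cancel₀ h2, one_smul]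
    rw [this]
    refine Submodule.add_mem_sup (Submodule.smul_mem _ _ ?_) (Submodule.smul_mem _ _ ?_)
    · rw [mem_plusSpace, map_add, hhx, add_comm]
    · rw [mem_minusSpace, map_sub, hhx, neg_sub]
  · rw [mem_plusSpace] at hx
    rw [LinearMap.mem_ker, LinearMap.sub_apply, sub_eq_zero, hx]
    nth_rewrite 2 [← hx]
    rw [hl]
  · rw [mem_minusSpace] at hx
    rw [LinearMap.mem_ker, LinearMap.sub_apply, sub_eq_zero, hx]
    have := hl x
    rw [hx, map_neg] at this
    exact (neg_eq_iff_eq_neg.1 this).symm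

variable [FiniteDimensional F V] {h : Q.IsometryEquiv Q}

theorem finrank_ker_sub_symm (h2 : (2 : F) ≠ 0) :
    Module.finrank F (LinearMap.ker (toEnd h - toEnd h.symm)) =
      Module.finrank F (plusSpace h) + Module.finrank F (minusSpace h) := by
  have h3 := Submodule.finrank_sup_add_finrank_inf_eq (plusSpace h) (minusSpace h)
  have h4 : plusSpace h ⊓ minusSpace h = ⊥ := by
    refine eq_bot_iff.2 fun x hx => ?_
    have h5 := (mem_plusSpace h).1 hx.1
    rw [(mem_minusSpace h).1 hx.2] at h5
    have h6 : (2 : F) • x = 0 := by rw [two_smul]; nth_rewrite 1 [← h5]; exact neg_add_cancel x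
    exact (smul_eq_zero.1 h6).resolve_left h2
  rw [h4, finrank_bot, add_zero] at h3
  rw [ker_sub_symm_eq h2, h3]

/-- An isometric involution inverting `h` preserves every block of `h`, with determinant given by
half the dimension. -/
theorem hasDetOn_properBlock (h2 : (2 : F) ≠ 0) (hsum : IsOrthogonalDirectSum Q (allBlocks h))
    {β : Q.IsometryEquiv Q} (hi : ∀ x, toEnd β (toEnd β x) = x)
    (hinv : ∀ x, toEnd h (toEnd β (toEnd h x)) = toEnd β x)
    {W : Submodule F V} (hW : W ∈ properBlocks h) :
    Even (Module.finrank F W) ∧ HasDetOn β W ((-1) ^ halfDim (Module.finrank F W)) := by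
  have hr : ∀ y, toEnd h (toEnd h.symm y) = y := h.apply_symm_apply
  have hl : ∀ y, toEnd h.symm (toEnd h y) = y := h.symm_apply_apply
  have c1 : ∀ x, toEnd β (toEnd h x) = toEnd h.symm (toEnd β x) := fun x => by rw [← hinv x, hl]
  have c2 : ∀ x, toEnd β (toEnd h.symm x) = toEnd h (toEnd β x) := fun x => by
    rw [← hinv, hr]
  have hNdis : Disjoint W (LinearMap.ker (toEnd h - toEnd h.symm)) := by
    rw [ker_sub_symm_eq h2]
    refine (hsum.1 (Sum.inl ⟨W, hW⟩)).mono_right (sup_le ?_ ?_)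
    · exact le_iSup₂_of_le (Sum.inr true) (by simp) le_rfl
    · exact le_iSup₂_of_le (Sum.inr false) (by simp) le_rfl
  obtain ⟨p, -, -, -, -, -, hWp⟩ := hW
  -- Inverting `h`, `β` exchanges `ker p(h)` and `ker p(h⁻¹)`.
  have hβW : ∀ x ∈ W, toEnd β x ∈ W := by
    rw [hWp]
    intro x hx
    obtain ⟨a, ha, b, hb, rfl⟩ := Submodule.mem_sup.1 hx
    rw [map_add, add_comm]
    refine Submodule.add_mem_sup ?_ ?_
    · rw [LinearMap.mem_ker, ← aeval_intertwine (f := toEnd β) c2, LinearMap.mem_ker.1 hb, map_zero]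
    · rw [LinearMap.mem_ker, ← aeval_intertwine (f := toEnd β) c1, LinearMap.mem_ker.1 ha, map_zero]
  have hhW : ∀ x ∈ W, toEnd h x ∈ W := by
    rw [hWp]
    intro x hx
    obtain ⟨a, ha, b, hb, rfl⟩ := Submodule.mem_sup.1 hx
    rw [map_add]
    refine Submodule.add_mem_sup ?_ ?_
    · rw [LinearMap.mem_ker, ← aeval_intertwine (f := toEnd h) (fun _ => rfl),
        LinearMap.mem_ker.1 ha, map_zero]
    · rw [LinearMap.mem_ker, ← aeval_intertwine (f := toEnd h) (S := toEnd h.symm)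
        (fun x => by rw [hl, hr]), LinearMap.mem_ker.1 hb, map_zero]
  have hNW : ∀ x ∈ W, (toEnd h - toEnd h.symm) x ∈ W := fun x hx =>
    W.sub_mem (hhW x hx) (inverse_mem (symm_mul_toEnd h) hhW hx)
  have hi' : ∀ x : W, (toEnd β).restrict hβW ((toEnd β).restrict hβW x) = x :=
    fun x => Subtype.ext (hi x)
  have hker : LinearMap.ker ((toEnd h - toEnd h.symm).restrict hNW) = ⊥ := by
    refine eq_bot_iff.2 fun x hx => ?_
    have h3 : (toEnd h - toEnd h.symm) x = 0 := congrArg Subtype.val hx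
    exact Subtype.ext ((Submodule.disjoint_def.1 hNdis) x x.2 h3)
  -- `h - h⁻¹` is injective on `W`, so both eigenspaces of `β` on `W` have half the dimension; this
  -- also proves evenness.
  have hfin := finrank_eigenspaces_of_anticommute (N := (toEnd h - toEnd h.symm).restrict hNW) hi'
    (fun x => Subtype.ext (by
      change toEnd β (toEnd h x - toEnd h.symm x) =
        -(toEnd h (toEnd β x) - toEnd h.symm (toEnd β x))
      rw [map_sub, c1, c2, neg_sub])) (by rw [hker]; exact disjoint_bot_left) h2
  rw [hker, inf_bot_eq, inf_bot_eq, finrank_bot, add_zero, add_zero] at hfin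
  refine ⟨⟨_, by rw [← hfin, two_mul]⟩, hβW, ?_⟩
  rw [det_of_involution hi' h2, ← hfin, halfDim]
  congr 1
  omega

end Dets

/-! ### Factoring `g` through the lifts of two involutions. -/

section Factorization

variable {F : Type*} [Field F] {V : Type*} [AddCommGroup V] [Module F V] [FiniteDimensional F V]
  [CharZero F] {Q : QuadraticForm F V}

/-- `g*` is conjugate to `±g` by the lift of an isometric involution inverting `P(g)`. -/
theorem exists_conj_canonicalInvolution (hB : Q.polarBilin.Nondegenerate) (g : GPin Q)
    (ss : (toEnd (proj g)).IsSemisimple) :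
    ∃ (η : GPin Q) (s : ℕ), (∀ x, toEnd (proj η) (toEnd (proj η) x) = x) ∧
      (∀ x, toEnd (proj g) (toEnd (proj η) (toEnd (proj g) x)) = toEnd (proj η) x) ∧
      (∀ x ∈ plusSpace (proj g) ⊔ minusSpace (proj g), toEnd (proj η) x = x) ∧
      LinearMap.det (toEnd (proj η)) = (-1) ^ s ∧
      2 * s + Module.finrank F (plusSpace (proj g)) + Module.finrank F (minusSpace (proj g)) =
        Module.finrank F V ∧
      cl (η * canonicalInvolution g * η⁻¹) =
        (-1 : F) ^ (s.choose 2 + (s + Module.finrank F (minusSpace (proj g))).choose 2) • cl g ∧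
      involute (cl g) = (-1 : F) ^ Module.finrank F (minusSpace (proj g)) • cl g := by
  have h2 : (2 : F) ≠ 0 := two_ne_zero
  set h := proj g with hh
  have hr : ∀ y, toEnd h (toEnd h.symm y) = y := h.apply_symm_apply
  have hl : ∀ y, toEnd h.symm (toEnd h y) = y := h.symm_apply_apply
  obtain ⟨β, hi, ho, hinv, hfix⟩ := exists_inverting_involution hB (polar_isSymm Q)
    (toEnd_mul_symm h) (symm_mul_toEnd h) (polar_adjoint h) ss h2
  have c1 : ∀ x, β (toEnd h x) = toEnd h.symm (β x) := fun x => by rw [← hinv x, hl]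
  have c2 : ∀ x, β (toEnd h.symm x) = toEnd h (β x) := fun x => by rw [← hinv, hr]
  set N := toEnd h - toEnd h.symm with hN
  have hNa : ∀ x, N x = toEnd h x - toEnd h.symm x := fun x => rfl
  have hK : ∀ x ∈ LinearMap.ker N, β x = x := fun x hx =>
    hfix x (sub_eq_zero.1 (LinearMap.mem_ker.1 hx))
  have hdis := (isCompl_ker_range_sub (toEnd_mul_symm h) (symm_mul_toEnd h) ss).disjoint
  have hKeq : LinearMap.ker N = plusSpace h ⊔ minusSpace h := ker_sub_symm_eq h2
  have hKfin : Module.finrank F (LinearMap.ker N) = _ := finrank_ker_sub_symm h2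
  have hβN : ∀ x, β (N x) = -N (β x) := fun x => by
    rw [hNa, hNa, map_sub, c1, c2, neg_sub]
  set ρ : Module.End F V := toEnd h * β with hρ
  have hρa : ∀ x, ρ x = toEnd h (β x) := fun x => rfl
  have hρi : ∀ x, ρ (ρ x) = x := fun x => by rw [hρa, hρa, hinv, hi]
  have hρo : ∀ x y, Q.polarBilin (ρ x) (ρ y) = Q.polarBilin x y := fun x y => by
    rw [hρa, hρa, polar_toEnd, ho]
  have hρN : ∀ x, ρ (N x) = -N (ρ x) := fun x => by
    rw [hρa, hβN, hNa, hNa, hρa, hl, map_neg, map_sub, hr]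
  -- On `ker N` the involution `β` is the identity and `ρ` coincides with `h`. Hence the correction
  -- terms are `ker N` and `0` for `β`, but `V₊` and `V₋` for `ρ`.
  have f1 := finrank_eigenspaces_of_anticommute hi hβN hdis h2
  have f2 := finrank_eigenspaces_of_anticommute hρi hρN hdis h2
  have k1 : LinearMap.ker (β - 1) ⊓ LinearMap.ker N = LinearMap.ker N := by
    refine inf_eq_right.2 fun x hx => ?_
    change β x - x = 0
    rw [hK x hx, sub_self]
  have k2 : LinearMap.ker (β + 1) ⊓ LinearMap.ker N = ⊥ := by
    rw [← k1, ← inf_assoc, inf_comm (LinearMap.ker (β + 1)),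
      (isCompl_ker_of_involution hi h2).inf_eq_bot, bot_inf_eq]
  have k3 : LinearMap.ker (ρ - 1) ⊓ LinearMap.ker N = plusSpace h := by
    refine le_antisymm (fun x hx => ?_) (fun x hx => ?_)
    · have h3 : toEnd h (β x) - x = 0 := hx.1
      rw [hK x hx.2, sub_eq_zero] at h3
      exact (mem_plusSpace h).2 h3
    · have h4 : x ∈ LinearMap.ker N := hKeq ▸ Submodule.mem_sup_left hx
      refine ⟨?_, h4⟩
      change toEnd h (β x) - x = 0
      rw [hK x h4, (mem_plusSpace h).1 hx, sub_self]
  have k4 : LinearMap.ker (ρ + 1) ⊓ LinearMap.ker N = minusSpace h := by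
    refine le_antisymm (fun x hx => ?_) (fun x hx => ?_)
    · have h3 : toEnd h (β x) + x = 0 := hx.1
      rw [hK x hx.2] at h3
      exact (mem_minusSpace h).2 (eq_neg_of_add_eq_zero_left h3)
    · have h4 : x ∈ LinearMap.ker N := hKeq ▸ Submodule.mem_sup_right hx
      refine ⟨?_, h4⟩
      change toEnd h (β x) + x = 0
      rw [hK x h4, (mem_minusSpace h).1 hx, neg_add_cancel]
  rw [k1, k2, finrank_bot, hKfin] at f1
  rw [k3, k4] at f2
  obtain ⟨u, hu, hurev, huinv⟩ := exists_lift_involution hB _ β hi ho rfl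
  obtain ⟨u', hu', hurev', huinv'⟩ := exists_lift_involution hB
    (Module.finrank F (LinearMap.ker (β + 1)) + Module.finrank F (minusSpace h)) ρ hρi hρo
    (by omega)
  set s := Module.finrank F (LinearMap.ker (β + 1)) with hs
  set d := Module.finrank F (minusSpace h) with hd
  have huu : toEnd (proj (u' * u)) = toEnd h := by
    rw [toEnd_proj_mul, hu, hu']
    exact LinearMap.ext fun x => by rw [Module.End.mul_apply, hρa, hi]
  have hx1 : toEnd (proj (g * (u' * u)⁻¹)) = 1 := by
    rw [toEnd_proj_mul, ← hh, ← huu, toEnd_proj_inv]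
  obtain ⟨a, ha⟩ := mem_range_algebraMap_of_twisted_central hB
    (x := cl (g * (u' * u)⁻¹)) (fun v => by
      rw [← ι_toEnd_proj_mul, hx1]; rfl)
  -- `g` and `u' u` have the same image `h = ρβ`, so they differ by a scalar.
  have hg : cl g = a • (cl u' * cl u) := by
    have h3 : g = g * (u' * u)⁻¹ * (u' * u) := by group
    rw [h3, cl_mul _ (u' * u), ← ha, cl_mul, Algebra.smul_def]
  have hη : toEnd (proj u⁻¹) = β := by
    have h3 := toEnd_proj_inv u
    rw [hu] at h3
    refine LinearMap.ext fun x => ?_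
    have h4 := congrArg β (LinearMap.congr_fun h3 x)
    rwa [Module.End.mul_apply, hi] at h4
  -- The witness is `u⁻¹` because `u⁻¹ (u u') u = u' u`; its image under `P` is again `β`.
  refine ⟨u⁻¹, s, ?_, ?_, ?_, ?_, ?_, ?_, ?_⟩
  · rw [hη]; exact hi
  · rw [hη]; exact hinv
  · rw [hη, ← hKeq]; exact hK
  · rw [hη, det_of_involution hi h2]
  · omega
  · have h3 : cl (canonicalInvolution g) = reverse (cl g) := rfl
    rw [cl_mul, cl_mul, h3, hg, map_smul, reverse.map_mul, hurev, hurev', inv_inv]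
    simp only [smul_mul_assoc, mul_smul_comm, smul_smul]
    rw [← mul_assoc (cl u⁻¹), cl_inv_mul, one_mul, pow_add]
    congr 1
    ring
  · rw [hg, map_smul, map_mul, huinv, huinv']
    simp only [smul_mul_assoc, mul_smul_comm, smul_smul]
    congr 1
    rw [pow_add]
    have h3 : (-1 : F) ^ s * (-1) ^ s = 1 := by rw [← mul_pow]; simp
    linear_combination (a * (-1) ^ d) * h3

end Factorization

end GeneralPin

end

noncomputable section

namespace GeneralPin

/-! ### Parity of the reversal signs. -/

section Signs

theorem add_choose_two (a b : ℕ) : (a + b).choose 2 = a.choose 2 + a * b + b.choose 2 := by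
  induction b with
  | zero => simp
  | succ b ih =>
    rw [← add_assoc, Nat.choose_succ_succ' (a + b) 1, Nat.choose_succ_succ' b 1, ih,
      Nat.choose_one_right, Nat.choose_one_right]
    ring

/-- Modulo 2 the terms `2 * s.choose 2` and `2 * s * l` drop out, leaving `(2 * l).choose 2 = l * (2
* l - 1)`, which has the parity of `l`. -/
theorem neg_one_pow_choose_even {R : Type*} [Ring R] (s l : ℕ) :
    (-1 : R) ^ (s.choose 2 + (s + (l + l)).choose 2) = (-1) ^ l := by
  apply neg_one_pow_congr
  rw [add_choose_two, add_choose_two]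
  simp only [Nat.even_add, Nat.even_mul]
  tauto

theorem neg_one_pow_choose_odd {R : Type*} [Ring R] (s l : ℕ) :
    (-1 : R) ^ (s.choose 2 + (s + (l + l + 1)).choose 2) = (-1) ^ (s + l) := by
  apply neg_one_pow_congr
  rw [add_choose_two, add_choose_two, add_choose_two]
  have h1 : Nat.choose 1 2 = 0 := rfl
  simp only [Nat.even_add, Nat.even_mul, h1, Nat.even_add_one, Even.zero, mul_one]
  tauto

end Signs

/-! ### Correcting determinants and signs by a vector of `V₊` or `V₋`. -/

section Conjugation

variable {F : Type*} [Field F] {V : Type*} [AddCommGroup V] [Module F V]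
variable {Q : QuadraticForm F V}

theorem cl_conj_smul (t x y : GPin Q) {c : F} (hx : cl x = c • cl y) :
    cl (t * x * t⁻¹) = c • cl (t * y * t⁻¹) := by
  rw [cl_mul, cl_mul, hx, mul_smul_comm, smul_mul_assoc, ← cl_mul, ← cl_mul]

theorem cl_ne_zero [NeZero (2 : F)] (g : GPin Q) : cl g ≠ 0 := by
  have : Invertible (2 : F) := invertibleOfNonzero (NeZero.ne 2)
  exact (g : (CliffordAlgebra Q)ˣ).ne_zero

theorem neg_cl_ne [NeZero (2 : F)] (g : GPin Q) : -cl g ≠ cl g := by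
  intro h0
  have h1 : (2 : F) • cl g = 0 := by rw [two_smul]; nth_rewrite 1 [← h0]; exact neg_add_cancel _
  exact (smul_eq_zero.1 h1).elim (NeZero.ne 2) (cl_ne_zero g)

variable [NeZero (2 : F)] [FiniteDimensional F V]

/-- For even `g`, an element of `GPin` with prescribed determinant on `V₊` or `V₋` and acting
trivially on the other blocks; it commutes with `g` up to an explicit sign. -/
theorem exists_vec_of_allBlocks (g : GPin Q) (hB : Q.polarBilin.Nondegenerate)
    (hsum : IsOrthogonalDirectSum Q (allBlocks (proj g))) (b : Bool) (δ : ℤˣ)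
    (hδ : allBlocks (proj g) (Sum.inr b) = ⊥ → δ = 1) (heven : involute (cl g) = cl g) :
    ∃ t : GPin Q, (∀ j, j ≠ Sum.inr b → HasDetOn (proj t) (allBlocks (proj g) j) 1) ∧
      HasDetOn (proj t) (allBlocks (proj g) (Sum.inr b)) ((δ : ℤ) : F) ∧
      LinearMap.det (toEnd (proj t)) = ((δ : ℤ) : F) ∧
      cl (t * g * t⁻¹) = (if b then (1 : F) else ((δ : ℤ) : F)) • cl g := by
  rcases Int.units_eq_one_or δ with rfl | rfl
  · have h1 : ∀ W : Submodule F V, HasDetOn (proj (1 : GPin Q)) W 1 := fun W =>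
      hasDetOn_one_of_fixed fun x _ => by rw [toEnd_proj_one]; rfl
    refine ⟨1, fun j _ => h1 _, by simpa using h1 _, ?_, ?_⟩
    · rw [toEnd_proj_one, map_one]; simp
    · simp
  · obtain ⟨v, hvW, hv⟩ := hsum.exists_anisotropic hB (i := Sum.inr b)
      (fun h0 => absurd (hδ h0) (by decide))
    refine ⟨vec v hv, fun j hj => ?_, ?_, ?_, ?_⟩
    · exact hasDetOn_vec_of_orthogonal hv fun x hx => hsum.2.2 _ j hj.symm v hvW x hx
    · simpa using hasDetOn_vec_of_mem hv hvW
    · simpa using (hasDetOn_vec_of_mem hv (Submodule.mem_top (x := v))).det_eq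
    · cases b
      · rw [vec_conj_of_minus g hv ((mem_minusSpace _).1 hvW), heven]; simp
      · rw [vec_conj_of_plus g hv ((mem_plusSpace _).1 hvW), heven]; simp

end Conjugation

/-! ### Conjugating `σ_V(g)` to `g`. -/

section Main

variable {F : Type*} [Field F] {V : Type*} [AddCommGroup V] [Module F V]
  {Q : QuadraticForm F V}

theorem sigmaV_of_mem_GSpin {g : GPin Q} (hg : (g : (CliffordAlgebra Q)ˣ) ∈ GSpin Q) :
    sigmaV g = canonicalInvolution g := by
  simp [sigmaV, sign, hg]

theorem cl_sigmaV_of_notMem_GSpin {g : GPin Q} (hg : (g : (CliffordAlgebra Q)ˣ) ∉ GSpin Q) :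
    cl (sigmaV g) = (if Even (Module.finrank F V) then (1 : F)
      else (-1) ^ (halfDim (Module.finrank F V) + 1)) • cl (canonicalInvolution g) := by
  have h1 : ∀ n : ℕ, cl ((⟨-1, neg_one_mem⟩ : GPin Q) ^ n) =
      (-1 : F) ^ n • (1 : CliffordAlgebra Q) := by
    intro n
    induction n with
    | zero => rw [pow_zero, pow_zero, one_smul]; rfl
    | succ n ih =>
      have h3 : cl (⟨-1, neg_one_mem⟩ : GPin Q) = -1 := rfl
      rw [pow_succ, cl_mul, ih, h3, pow_succ]
      simp
  rw [sigmaV]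
  split_ifs
  · rw [one_smul]
  · rw [sign, if_neg hg, cl_mul, h1, smul_mul_assoc, one_mul]

theorem even_finrank_minusSpace_iff [NeZero (2 : F)] (g : GPin Q)
    (hinv : involute (cl g) = (-1 : F) ^ Module.finrank F (minusSpace (proj g)) • cl g) :
    (g : (CliffordAlgebra Q)ˣ) ∈ GSpin Q ↔ Even (Module.finrank F (minusSpace (proj g))) := by
  rw [mem_GSpin_iff, hinv]
  refine ⟨fun h1 => ?_, fun h1 => by rw [h1.neg_one_pow, one_smul]⟩
  by_contra h2
  rw [(Nat.not_even_iff_odd.1 h2).neg_one_pow, neg_one_smul] at h1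
  exact neg_cl_ne g h1

variable [FiniteDimensional F V] [CharZero F]

/-- Elements of `GSpin` are conjugate to their image under the canonical involution by elements
with prescribed determinants on the blocks. -/
theorem exists_conj_of_mem_GSpin (hB : Q.polarBilin.Nondegenerate) (g : GPin Q)
    (ss : (toEnd (proj g)).IsSemisimple) (hg : (g : (CliffordAlgebra Q)ˣ) ∈ GSpin Q) (δ : ℤˣ)
    (hδ : plusSpace (proj g) = ⊥ → δ = 1) :
    ∃ (η : GPin Q) (s l : ℕ), Module.finrank F (minusSpace (proj g)) = l + l ∧
      2 * s + Module.finrank F (plusSpace (proj g)) + (l + l) = Module.finrank F V ∧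
      η * sigmaV g * η⁻¹ = g ∧ HasBlockDets (proj g) (proj η) δ ∧
      LinearMap.det (toEnd (proj η)) = ((δ : ℤ) : F) * (-1) ^ (l + s) := by
  have hsum := isOrthogonalDirectSum_allBlocks (proj g) hB two_ne_zero ss
  obtain ⟨η, s, hi, hhi, hfix, hdet, hdim, hconj, hinv⟩ := exists_conj_canonicalInvolution hB g ss
  have heven := (mem_GSpin_iff g).1 hg
  obtain ⟨l, hl⟩ := (even_finrank_minusSpace_iff g hinv).1 hg
  rw [hl, neg_one_pow_choose_even] at hconj
  have hcast : ((((-1 : ℤˣ) ^ l : ℤˣ) : ℤ) : F) = (-1) ^ l := by push_cast; rfl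
  obtain ⟨t, ht1, ht2, ht3, ht4⟩ := exists_vec_of_allBlocks g hB hsum true δ hδ heven
  -- The determinant wanted on `V₋` is the sign `(-1) ^ l` left over by `η`, and conjugation by `r`
  -- contributes the same sign, so one choice settles both. The element `t` adjusts `V₊` and
  -- commutes with `g`.
  obtain ⟨r, hr1, hr2, hr3, hr4⟩ := exists_vec_of_allBlocks g hB hsum false ((-1) ^ l) (fun h0 => by
    have h1 : minusSpace (proj g) = ⊥ := h0
    rw [h1, finrank_bot] at hl
    rw [show l = 0 by omega, pow_zero]) heven
  rw [hcast] at hr2 hr3 hr4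
  simp only [if_true, one_smul, Bool.false_eq_true, if_false] at ht4 hr4
  refine ⟨t * (r * η), s, l, hl, by omega, ?_, ⟨?_, ?_, ?_⟩, ?_⟩
  · apply cl_injective
    have e1 : t * (r * η) * sigmaV g * (t * (r * η))⁻¹ =
        t * (r * (η * sigmaV g * η⁻¹) * r⁻¹) * t⁻¹ := by group
    have e2 := cl_conj_smul r (η * sigmaV g * η⁻¹) g (by
      rw [sigmaV_of_mem_GSpin hg]; exact hconj)
    rw [hr4, smul_smul, ← mul_pow, neg_one_mul, neg_neg, one_pow] at e2
    rw [e1, cl_conj_smul t _ g e2, ht4, one_smul]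
  · intro W hW
    have h0 := (hasDetOn_properBlock two_ne_zero hsum hi hhi hW).2
    have h1 := hr1 (Sum.inl ⟨W, hW⟩) (by simp)
    have h2 := ht1 (Sum.inl ⟨W, hW⟩) (by simp)
    simpa [allBlocks] using HasDetOn.mul h2 (HasDetOn.mul h1 h0)
  · have h0 : HasDetOn (proj η) (plusSpace (proj g)) 1 :=
      hasDetOn_one_of_fixed fun x hx => hfix x (Submodule.mem_sup_left hx)
    have h1 := hr1 (Sum.inr true) (by simp)
    simpa [allBlocks] using HasDetOn.mul ht2 (HasDetOn.mul h1 h0)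
  · have h0 : HasDetOn (proj η) (minusSpace (proj g)) 1 :=
      hasDetOn_one_of_fixed fun x hx => hfix x (Submodule.mem_sup_right hx)
    have h1 := ht1 (Sum.inr false) (by simp)
    have h2 := HasDetOn.mul h1 (HasDetOn.mul hr2 h0)
    rw [hl, show halfDim (l + l) = l by rw [halfDim]; omega]
    simpa [allBlocks] using h2
  · rw [toEnd_proj_mul, toEnd_proj_mul, map_mul, map_mul, ht3, hr3, hdet, pow_add]

/-- Here `α(g) = -g`, so a wrong sign is repaired by any anisotropic vector of `V₊`. -/
theorem exists_conj_of_notMem_GSpin (hB : Q.polarBilin.Nondegenerate) (g : GPin Q)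
    (ss : (toEnd (proj g)).IsSemisimple) (hg : (g : (CliffordAlgebra Q)ˣ) ∉ GSpin Q) :
    ∃ η : GPin Q, η * sigmaV g * η⁻¹ = g := by
  have hsum := isOrthogonalDirectSum_allBlocks (proj g) hB two_ne_zero ss
  obtain ⟨η, s, -, -, -, -, hdim, hconj, hinv⟩ := exists_conj_canonicalInvolution hB g ss
  obtain ⟨l, hl⟩ := Nat.not_even_iff_odd.1 (mt (even_finrank_minusSpace_iff g hinv).2 hg)
  rw [two_mul] at hl
  rw [hl, neg_one_pow_choose_odd] at hconj
  rw [(Nat.not_even_iff_odd.1 (mt (even_finrank_minusSpace_iff g hinv).2 hg)).neg_one_pow,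
    neg_one_smul] at hinv
  set τ : F := if Even (Module.finrank F V) then (1 : F)
      else (-1) ^ (halfDim (Module.finrank F V) + 1) with hτ
  have e1 : cl (η * sigmaV g * η⁻¹) = (τ * (-1) ^ (s + l)) • cl g := by
    rw [cl_conj_smul η _ _ (cl_sigmaV_of_notMem_GSpin hg), hconj, smul_smul]
  have hpm : τ * (-1) ^ (s + l) = 1 ∨ τ * (-1) ^ (s + l) = -1 := by
    rw [hτ]
    split_ifs
    · rw [one_mul]; exact neg_one_pow_eq_or F _
    · rw [← pow_add]; exact neg_one_pow_eq_or F _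
  rcases hpm with hp | hp
  · exact ⟨η, cl_injective (by rw [e1, hp, one_smul])⟩
  -- If `V₊ = 0`, then `n = 2(s + l) + 1` and `k + 1 = s + l + 2`, so the factor `(-1) ^ (k + 1)`
  -- from `σ_V` cancels `(-1) ^ (s + l)` and the sign cannot be `-1`.
  have hplus : plusSpace (proj g) ≠ ⊥ := by
    intro h0
    rw [h0, finrank_bot, hl] at hdim
    have hodd : ¬ Even (Module.finrank F V) := by
      rw [Nat.not_even_iff_odd]; exact ⟨s + l, by omega⟩
    have hk : halfDim (Module.finrank F V) + 1 = s + l + 2 := by rw [halfDim]; omega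
    rw [hτ, if_neg hodd, hk, ← pow_add, Even.neg_one_pow ⟨s + l + 1, by omega⟩] at hp
    have : (2 : F) = 0 := by linear_combination hp
    exact two_ne_zero this
  obtain ⟨v, hvW, hv⟩ := hsum.exists_anisotropic hB (i := Sum.inr true) hplus
  refine ⟨vec v hv * η, cl_injective ?_⟩
  have e2 : vec v hv * η * sigmaV g * (vec v hv * η)⁻¹ =
      vec v hv * (η * sigmaV g * η⁻¹) * (vec v hv)⁻¹ := by group
  rw [e2, cl_conj_smul _ _ g e1, vec_conj_of_plus g hv ((mem_plusSpace _).1 hvW), hinv, hp,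
    neg_smul, one_smul, neg_neg]

end Main

end GeneralPin

end

theorem theorem3 {F : Type*} [Field F] [ValuativeRel F] [TopologicalSpace F]
    [IsNonarchimedeanLocalField F] [CharZero F]
    {V : Type*} [AddCommGroup V] [Module F V] [FiniteDimensional F V]
    (Q : QuadraticForm F V) (hQ : Q.Nondegenerate)
    (g : GeneralPin.GPin Q) (hg : GeneralPin.IsSemisimpleElt g) :
    -- the decomposition `V = V₁ ⊕ ⋯ ⊕ V_m ⊕ V₊ ⊕ V₋` attached to `h = P(g)`
    (GeneralPin.IsOrthogonalDirectSum Q (GeneralPin.allBlocks (GeneralPin.proj g)) ∧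
      ∀ W ∈ GeneralPin.properBlocks (GeneralPin.proj g), Even (Module.finrank F W)) ∧
    -- `g` and `σ_V(g)` are conjugate in `GPin(V)`
    (∃ η : GeneralPin.GPin Q, η * GeneralPin.sigmaV g * η⁻¹ = g) ∧
    -- the refinement for `g ∈ GSpin(V)`
    ((g : (CliffordAlgebra Q)ˣ) ∈ GeneralPin.GSpin Q →
      Even (Module.finrank F (GeneralPin.minusSpace (GeneralPin.proj g))) ∧
      (∀ δ : ℤˣ, (GeneralPin.plusSpace (GeneralPin.proj g) = ⊥ → δ = 1) →
        ∃ η : GeneralPin.GPin Q, η * GeneralPin.sigmaV g * η⁻¹ = g ∧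
          GeneralPin.HasBlockDets (GeneralPin.proj g) (GeneralPin.proj η) δ) ∧
      (∃ (η : GeneralPin.GPin Q) (δ : ℤˣ), η * GeneralPin.sigmaV g * η⁻¹ = g ∧
        GeneralPin.HasBlockDets (GeneralPin.proj g) (GeneralPin.proj η) δ ∧
        LinearMap.det (GeneralPin.toEnd (GeneralPin.proj η)) =
          (-1) ^ GeneralPin.halfDim (Module.finrank F V))) := by
  have : Invertible (2 : F) := invertibleOfNonzero two_ne_zero
  have hB := QuadraticMap.nondegenerate_polar_iff.2 hQ
  have ss := GeneralPin.isSemisimple_proj g hg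
  have hsum := GeneralPin.isOrthogonalDirectSum_allBlocks (GeneralPin.proj g) hB two_ne_zero ss
  refine ⟨⟨hsum, fun W hW => ?_⟩, ?_, fun hS => ⟨?_, fun δ hδ => ?_, ?_⟩⟩
  · obtain ⟨η, -, hi, hhi, -⟩ := GeneralPin.exists_conj_canonicalInvolution hB g ss
    exact (GeneralPin.hasDetOn_properBlock two_ne_zero hsum hi hhi hW).1
  · by_cases hS : (g : (CliffordAlgebra Q)ˣ) ∈ GeneralPin.GSpin Q
    · obtain ⟨η, -, -, -, -, h1, -⟩ :=
        GeneralPin.exists_conj_of_mem_GSpin hB g ss hS 1 (fun _ => rfl)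
      exact ⟨η, h1⟩
    · exact GeneralPin.exists_conj_of_notMem_GSpin hB g ss hS
  · obtain ⟨-, -, l, hl, -⟩ := GeneralPin.exists_conj_of_mem_GSpin hB g ss hS 1 (fun _ => rfl)
    exact ⟨l, hl⟩
  · obtain ⟨η, -, -, -, -, h1, h2, -⟩ := GeneralPin.exists_conj_of_mem_GSpin hB g ss hS δ hδ
    exact ⟨η, h1, h2⟩
  -- The dimensions alone fix `s` and `l`, so a first application with `δ = 1` reads them off. Then
  -- `δ = (-1) ^ (k + l + s)` gives total determinant `(-1) ^ k`; if `V₊ = 0`, then `k = l + s` and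
  -- this `δ` is `1`, as required.
  · obtain ⟨-, s₀, l₀, hl₀, hd₀, -⟩ :=
      GeneralPin.exists_conj_of_mem_GSpin hB g ss hS 1 (fun _ => rfl)
    set k := GeneralPin.halfDim (Module.finrank F V) with hk
    obtain ⟨η, s, l, hl, hd, h1, h2, h3⟩ := GeneralPin.exists_conj_of_mem_GSpin hB g ss hS
      ((-1) ^ (k + (l₀ + s₀))) (fun h0 => by
        rw [h0, finrank_bot] at hd₀
        have : k = l₀ + s₀ := by rw [hk, GeneralPin.halfDim]; omega
        rw [this, Even.neg_one_pow ⟨_, rfl⟩])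
    refine ⟨η, _, h1, h2, ?_⟩
    have e1 : l = l₀ := by omega
    have e2 : s = s₀ := by omega
    subst e1 e2
    rw [h3]
    push_cast
    rw [pow_add, mul_assoc, ← mul_pow, neg_one_mul, neg_neg, one_pow, mul_one]
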